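/- An instance of Chromatic Correlation Clustering consists of a finite vertex set $V$, a nonempty finite set $L$ of colors, a partition of the edges of the complete graph on $V$ into $+$ edges $E^+$ and $-$ edges $E^-$, and a color $c_e\in L$ for every $e\in E^+$. A solution $(\mathcal C,\chi)$ is a partition $\mathcal C$ of $V$ together with a map $\chi:\mathcal C\to L$. Its cost is the number of disagreements, i.e. of $-$ edges inside a cluster, $+$ edges between different clusters, and $+$ edges $e$ inside a cluster $C$ with $\chi(C)\ne c_e$. Let $\mathrm{opt}$ be the minimum cost of a solution, and $n:=|V|$. A preclustered instance is a triple $(\mathcal K,\chi_{\mathsf{pre}},E_{\mathrm{adm}})$ where $\mathcal K$ is a partition of $V$ (into preclusters), $\chi_{\mathsf{pre}}$ assigns a color in $L$ to every $K\in\mathcal K$ with $|K|>1$, and $E_{\mathrm{adm}}$ is a set of pairs $uv$ of distinct vertices that lie in no common precluster (the admissible edges). A solution $(\mathcal C,\chi)$ respects it if every $K\in\mathcal K$ is contained in some $C\in\mathcal C$; if $\chi_{\mathsf{pre}}(K)=\chi(C)$ whenever $K\in\mathcal K$, $|K|>1$ and $K\subseteq C\in\mathcal C$; and if no two distinct vertices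 $u,v$ that lie in different preclusters with $uv\notin E_{\mathrm{adm}}$ are in the same cluster. Theorem. There are constants $\varepsilon_0>0$, $C_1$, $C_2$, a polynomial $p$ in two variables, and a deterministic algorithm with the following property. For every real $\varepsilon$ with $0<\varepsilon<\varepsilon_0$ and every instance, given the instance and $\lceil 1/\varepsilon\rceil$, the algorithm halts after at most $p(n,1/\varepsilon)$ steps (on a unit-cost random access machine with addition and subtraction, where a color is stored in one memory cell) and outputs a preclustered instance $(\mathcal K,\chi_{\mathsf{pre}},E_{\mathrm{adm}})$ such that (i) some solution respecting $(\mathcal K,\chi_{\mathsf{pre}},E_{\mathrm{adm}})$ has cost at most $(1+C_1\varepsilon)\,\mathrm{opt}$; and (ii) $|E_{\mathrm{adm}}|\le C_2\,\varepsilon^{-2}\,\mathrm{opt}$. -/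

import Mathlib

/-! ## Chromatic Correlation Clustering -/

namespace ChromaticCC

/-- An instance on the vertex set `V` and the color set `L`: a complete graph on `V` whose edges are
split into `+` edges (the edges of `pos`) and `-` edges (the other pairs of distinct vertices),
every `+` edge carrying a color. -/
structure Instance (V L : Type) where
  /-- the graph of `+` edges -/
  pos : SimpleGraph V
  /-- the color of each `+` edge -/
  color : pos.edgeSet → L

/-- A feasible solution: a partition of `V` into nonempty clusters, and a color for each cluster. -/
structure Solution (V L : Type) [Fintype V] [DecidableEq V] where
  /-- the clusters -/
  clusters : Finpartition (Finset.univ : Finset V)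
  /-- the color of each cluster -/
  color : {C : Finset V // C ∈ clusters.parts} → L

section Cost

variable {V L : Type} [Fintype V] [DecidableEq V]

/-- The edge joining `u` and `v` disagrees with the solution: it is a `-` edge inside a cluster, or
a `+` edge between different clusters, or a `+` edge inside a cluster of another color. -/
def Disagrees (I : Instance V L) (S : Solution V L) (u v : V) : Prop :=
  (¬ I.pos.Adj u v ∧ ∃ C ∈ S.clusters.parts, u ∈ C ∧ v ∈ C) ∨
  (I.pos.Adj u v ∧ ¬ ∃ C ∈ S.clusters.parts, u ∈ C ∧ v ∈ C) ∨
  (∃ (e : I.pos.edgeSet) (C : {C : Finset V // C ∈ S.clusters.parts}),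
    (e : Sym2 V) = s(u, v) ∧ u ∈ (C : Finset V) ∧ v ∈ (C : Finset V) ∧ S.color C ≠ I.color e)

/-- The cost of a solution: its number of disagreements, counted over the edges of the complete
graph on `V`, i.e. over the unordered pairs of distinct vertices. -/
noncomputable def cost (I : Instance V L) (S : Solution V L) : ℕ :=
  {e : Sym2 V | ∃ u v : V, u ≠ v ∧ e = s(u, v) ∧ Disagrees I S u v}.ncard

/-- The cost of an optimal solution. (Solutions exist as soon as there is a color, and the infimum
is then attained.) -/
noncomputable def opt (I : Instance V L) : ℕ :=
  sInf (Set.range (cost I))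

end Cost

/-- The data `(𝒦, χ_pre, E_adm)` of a preclustered instance. -/
structure Preclustering (V L : Type) [Fintype V] [DecidableEq V] where
  /-- the preclusters -/
  parts : Finpartition (Finset.univ : Finset V)
  /-- the color of each non-singleton precluster -/
  color : {K : Finset V // K ∈ parts.parts ∧ 1 < K.card} → L
  /-- the admissible edges -/
  adm : Finset (Sym2 V)
  /-- admissible edges join distinct vertices that lie in no common precluster -/
  adm_across : ∀ u v : V, s(u, v) ∈ adm → u ≠ v ∧ ¬ ∃ K ∈ parts.parts, u ∈ K ∧ v ∈ K

section Respects

variable {V L : Type} [Fintype V] [DecidableEq V]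

/-- `uv` is an atomic edge: `u ≠ v` lie in a common precluster. -/
def Preclustering.Atomic (P : Preclustering V L) (u v : V) : Prop :=
  u ≠ v ∧ ∃ K ∈ P.parts.parts, u ∈ K ∧ v ∈ K

/-- `uv` is a non-admissible edge: an edge that is neither atomic nor admissible. -/
def Preclustering.NonAdmissible (P : Preclustering V L) (u v : V) : Prop :=
  u ≠ v ∧ ¬ P.Atomic u v ∧ s(u, v) ∉ P.adm

/-- The solution `S` respects the preclustered instance `P`. -/
structure Respects (S : Solution V L) (P : Preclustering V L) : Prop where
  /-- the preclusters subdivide the clusters -/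
  subdivides : ∀ K ∈ P.parts.parts, ∃ C ∈ S.clusters.parts, K ⊆ C
  /-- a non-singleton precluster has the color of the cluster that contains it -/
  color_eq : ∀ (K : {K : Finset V // K ∈ P.parts.parts ∧ 1 < K.card})
    (C : {C : Finset V // C ∈ S.clusters.parts}),
    (K : Finset V) ⊆ (C : Finset V) → P.color K = S.color C
  /-- the ends of a non-admissible edge lie in different clusters -/
  nonadm : ∀ u v : V, P.NonAdmissible u v → ¬ ∃ C ∈ S.clusters.parts, u ∈ C ∧ v ∈ C

end Respects

/-! ## Random access machines

Unit-cost random access machines with structured control flow. A program uses finitely many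
registers and finitely many arrays; registers and array cells hold natural numbers, and array cells
are addressed indirectly, by the content of a register. The only arithmetic operations are addition
and truncated subtraction: without multiplication, numbers grow by at most one bit per step,
so that the number of unit-cost steps is an honest measure of time. -/

/-- The state of the machine: the contents of the registers and of the cells of the arrays. -/
structure State where
  /-- the registers -/
  reg : ℕ → ℕ
  /-- `arr a i` is the content of cell `i` of array `a` -/
  arr : ℕ → ℕ → ℕ

/-- Write `k` into register `x`. -/
def State.setReg (s : State) (x k : ℕ) : State :=
  { s with reg := Function.update s.reg x k }

/-- Write `k` into cell `i` of array `a`. -/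
def State.setArr (s : State) (a i k : ℕ) : State :=
  { s with arr := Function.update s.arr a (Function.update (s.arr a) i k) }

/-- Programs. The letters `x y z` are names of registers, `a` is the name of an array and `k` is a
numerical constant; all of them are fixed parts of the program. -/
inductive Program : Type
  /-- `x := k` -/
  | const (x k : ℕ)
  /-- `x := y` -/
  | copy (x y : ℕ)
  /-- `x := y + z` -/
  | add (x y z : ℕ)
  /-- `x := max (y - z) 0` -/
  | sub (x y z : ℕ)
  /-- `x := a[y]` -/
  | load (x a y : ℕ)
  /-- `a[x] := y` -/
  | store (a x y : ℕ)
  /-- first `p`, then `q` -/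
  | seq (p q : Program)
  /-- if `x < y` then `p` else `q` -/
  | ifLt (x y : ℕ) (p q : Program)
  /-- while `x < y` do `p` -/
  | whileLt (x y : ℕ) (p : Program)

/-- `Exec p s s' t`: started in state `s`, the program `p` halts in state `s'` after exactly `t`
steps. Every elementary instruction and every evaluation of a test is one step. -/
inductive Exec : Program → State → State → ℕ → Prop
  | const (s : State) (x k : ℕ) : Exec (.const x k) s (s.setReg x k) 1
  | copy (s : State) (x y : ℕ) : Exec (.copy x y) s (s.setReg x (s.reg y)) 1
  | add (s : State) (x y z : ℕ) : Exec (.add x y z) s (s.setReg x (s.reg y + s.reg z)) 1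
  | sub (s : State) (x y z : ℕ) : Exec (.sub x y z) s (s.setReg x (s.reg y - s.reg z)) 1
  | load (s : State) (x a y : ℕ) : Exec (.load x a y) s (s.setReg x (s.arr a (s.reg y))) 1
  | store (s : State) (a x y : ℕ) : Exec (.store a x y) s (s.setArr a (s.reg x) (s.reg y)) 1
  | seq {p q : Program} {s s' s'' : State} {t t' : ℕ} :
      Exec p s s' t → Exec q s' s'' t' → Exec (.seq p q) s s'' (t + t')
  | ifTrue {x y : ℕ} {p q : Program} {s s' : State} {t : ℕ} :
      s.reg x < s.reg y → Exec p s s' t → Exec (.ifLt x y p q) s s' (t + 1)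
  | ifFalse {x y : ℕ} {p q : Program} {s s' : State} {t : ℕ} :
      ¬ s.reg x < s.reg y → Exec q s s' t → Exec (.ifLt x y p q) s s' (t + 1)
  | whileTrue {x y : ℕ} {p : Program} {s s' s'' : State} {t t' : ℕ} :
      s.reg x < s.reg y → Exec p s s' t → Exec (.whileLt x y p) s' s'' t' →
      Exec (.whileLt x y p) s s'' (t + t' + 1)
  | whileFalse {x y : ℕ} {p : Program} {s : State} :
      ¬ s.reg x < s.reg y → Exec (.whileLt x y p) s s 1

/-! ## Input and output

Vertices are numbered `0, …, n - 1` and colors are numbered `0, …, m - 1`. -/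

open Classical in
/-- The code of the pair `(u, v)` in the input: `1 + c` for a `+` edge of color `c`, and `0` for a
`-` edge (and for `u = v`). -/
noncomputable def edgeCode {n m : ℕ} (I : Instance (Fin n) (Fin m)) (u v : Fin n) : ℕ :=
  if h : s(u, v) ∈ I.pos.edgeSet then 1 + (I.color ⟨s(u, v), h⟩ : ℕ) else 0

/-- The initial state on the parameter `k` and the instance `I`: the registers `0, 1, 2` hold `k`,
`n` and `m`, and array `0` holds the matrix of edge codes, row by row (the code of `(u, v)` is in
cell `n * u + v`). All other registers and cells hold `0`. -/
noncomputable def inputState {n m : ℕ} (k : ℕ) (I : Instance (Fin n) (Fin m)) : State where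
  reg x := if x = 0 then k else if x = 1 then n else if x = 2 then m else 0
  arr a i :=
    if h : a = 0 ∧ i < n * n then
      edgeCode I ⟨i / n, Nat.div_lt_of_lt_mul h.2⟩
        ⟨i % n, Nat.mod_lt i (Nat.pos_of_mul_pos_right (Nat.zero_lt_of_lt h.2))⟩
    else 0

/-- The state `s` holds the preclustered instance `P` as output: array `1` holds a name of the
precluster of each vertex (equal names meaning equal preclusters), array `2` holds the color of the
precluster of each vertex that lies in a non-singleton precluster, and array `3` holds the 0-1
matrix of the admissible edges, row by row. -/
structure Outputs {n m : ℕ} (s : State) (P : Preclustering (Fin n) (Fin m)) : Prop where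
  /-- the preclusters -/
  parts : ∀ u v : Fin n, s.arr 1 u = s.arr 1 v ↔ ∃ K ∈ P.parts.parts, u ∈ K ∧ v ∈ K
  /-- their colors -/
  color : ∀ (K : {K : Finset (Fin n) // K ∈ P.parts.parts ∧ 1 < K.card}),
    ∀ u ∈ (K : Finset (Fin n)), s.arr 2 u = (P.color K : ℕ)
  /-- the admissible edges -/
  adm : ∀ u v : Fin n, s.arr 3 (n * u + v) = if s(u, v) ∈ P.adm then 1 else 0

end ChromaticCC

/-! Call a `+` edge good if the number of its conflicts, the third vertices whose triangle with the
edge forces a further disagreement once the edge itself agrees, is at most 1/1000 of the sum of the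
degrees of its ends. In any solution a `+` edge that is not good either disagrees or sees many
disagreements at its ends, so a charging argument bounds the number of such edges by O(opt)
(`sum_bad_le`). The ends of a good edge have almost the same row of colors. So do two heavy vertices
(almost all of whose `+` edges are good) with a common good neighbor, and therefore linkage is
transitive (`Linked.trans`). A linkage class with a vertex that has too many `+` neighbors outside
is dissolved into singletons; the classes that are kept are the preclusters. Each step loses a
constant factor, so only O(opt) `+` edges run between preclusters (`sum_not_same_le`).

A pair in different preclusters is admissible if, for some scale `c`, it has at least `c / (k + 2)`
common neighbors of degree at most `(k + 2) c`, where `k = ⌈1/ε⌉`. Every common neighbor sends a `+`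
edge across preclusters, and sharing the unit charge of each such edge among the neighbors of one of
its ends bounds the number of admissible pairs by O(k² opt) (`sum_adm_le`).

The respecting solution minimizes a perturbed cost in which a disagreement costs between `k` and `k
+ 3`; this loses only a factor `1 + 3/k`. The perturbation makes the isolation of a vertex
attractive enough that, in a minimizer, each vertex of a cluster `C` is adjacent to more than half
of `C`, with a margin of order `|C| / k`, and has degree at most `(k + 2) |C|`. Two vertices of `C`
then satisfy the admissibility condition with `c = |C|` (`IsOptimal.same_or_adm`). Nontrivial
preclusters are dense, nearly monochromatic and nearly closed, so a minimizer puts each of them into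
one cluster of the right color (`IsOptimal.exists_label`). Only the existence of the minimizer is
used; it is never computed.

The preclustering itself is defined by quantifiers and counts over vertices. A small language of
expressions with sums over the vertices is compiled to the machine once and for all, with a running
time polynomial in `n` (`Ex.exec_compile`, `Stmt.exec_compile`). -/

namespace ChromaticCC

/-! ## A language of expressions and its compilation -/

/-- Arithmetic expressions over the parameters `k` and `n`, the variables `0, 1, 2, …` and the
input array. -/
inductive Ex : Type
  | parK | parN
  | var (j : ℕ)
  | lit (c : ℕ)
  | add (a b : Ex)
  | sub (a b : Ex)
  /-- the cell of array `0` with index `a` -/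
  | load (a : Ex)
  /-- the sum of `a` over all values of the variable `j` below `n` -/
  | sum (j : ℕ) (a : Ex)
  /-- if `a < b` then `p` else `q` -/
  | ite (a b p q : Ex)

/-- The value of an expression. -/
def Ex.eval (k n : ℕ) (input : ℕ → ℕ) : Ex → (ℕ → ℕ) → ℕ
  | .parK, _ => k
  | .parN, _ => n
  | .var j, ρ => ρ j
  | .lit c, _ => c
  | .add a b, ρ => a.eval k n input ρ + b.eval k n input ρ
  | .sub a b, ρ => a.eval k n input ρ - b.eval k n input ρ
  | .load a, ρ => input (a.eval k n input ρ)
  | .sum j a, ρ => ∑ i ∈ Finset.range n, a.eval k n input (Function.update ρ j i)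
  | .ite a b p q, ρ =>
      if a.eval k n input ρ < b.eval k n input ρ then p.eval k n input ρ else q.eval k n input ρ

/-- The register of the variable `j`. -/
def varReg (j : ℕ) : ℕ := 2 * j + 3

/-- The scratch register number `d`. -/
def tmpReg (d : ℕ) : ℕ := 2 * d + 4

/-- The program evaluating an expression into scratch register `d`, using only scratch registers
from `d` on. -/
def Ex.compile : Ex → ℕ → Program
  | .parK, d => .copy (tmpReg d) 0
  | .parN, d => .copy (tmpReg d) 1
  | .var j, d => .copy (tmpReg d) (varReg j)
  | .lit c, d => .const (tmpReg d) c
  | .add a b, d =>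
      .seq (a.compile d) (.seq (b.compile (d + 1)) (.add (tmpReg d) (tmpReg d) (tmpReg (d + 1))))
  | .sub a b, d =>
      .seq (a.compile d) (.seq (b.compile (d + 1)) (.sub (tmpReg d) (tmpReg d) (tmpReg (d + 1))))
  | .load a, d => .seq (a.compile d) (.load (tmpReg d) 0 (tmpReg d))
  | .sum j a, d =>
      .seq (.copy (tmpReg (d + 1)) (varReg j)) <|
      .seq (.const (tmpReg d) 0) <|
      .seq (.const (varReg j) 0) <|
      .seq (.const (tmpReg (d + 2)) 1) <|
      -- The `1` here is the register holding `n`, not the constant one, which sits in scratch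
      -- register `d + 2`.
      .seq (.whileLt (varReg j) 1 <|
        .seq (a.compile (d + 3)) <|
        .seq (.add (tmpReg d) (tmpReg d) (tmpReg (d + 3))) <|
        .add (varReg j) (varReg j) (tmpReg (d + 2))) <|
      .copy (varReg j) (tmpReg (d + 1))
  | .ite a b p q, d =>
      .seq (a.compile d) (.seq (b.compile (d + 1))
        (.ifLt (tmpReg d) (tmpReg (d + 1)) (p.compile d) (q.compile d)))

/-- A bound on the evaluation time, as a polynomial in `n`. -/
noncomputable def Ex.time : Ex → Polynomial ℕ
  | .parK => 1
  | .parN => 1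
  | .var _ => 1
  | .lit _ => 1
  | .add a b => a.time + b.time + 1
  | .sub a b => a.time + b.time + 1
  | .load a => a.time + 1
  | .sum _ a => Polynomial.X * (a.time + 3) + 6
  | .ite a b p q => a.time + b.time + p.time + q.time + 1

/-- The machine state represents the parameters, the input array and the variables. -/
structure Represents (k n : ℕ) (input ρ : ℕ → ℕ) (s : State) : Prop where
  parK : s.reg 0 = k
  parN : s.reg 1 = n
  var : ∀ j, s.reg (varReg j) = ρ j
  input : s.arr 0 = input

/-! ### Register allocation and correctness of compiled expressions -/

lemma varReg_ne_tmpReg (j d : ℕ) : varReg j ≠ tmpReg d := by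
  simp only [varReg, tmpReg]; omega

lemma varReg_inj {i j : ℕ} : varReg i = varReg j ↔ i = j := by
  simp only [varReg]; omega

lemma tmpReg_inj {i j : ℕ} : tmpReg i = tmpReg j ↔ i = j := by
  simp only [tmpReg]; omega

/-- Scratch registers are the even ones from 4 on, hence disjoint from the parameters and the
variables. -/
lemma Represents.congr {k n : ℕ} {input ρ : ℕ → ℕ} {s s' : State} (h : Represents k n input ρ s)
    {d : ℕ} (hr : ∀ x, (∀ i, d ≤ i → x ≠ tmpReg i) → s'.reg x = s.reg x)
    (ha : s'.arr 0 = s.arr 0) : Represents k n input ρ s' where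
  parK := by rw [hr 0 (fun i _ => by simp only [tmpReg]; omega), h.parK]
  parN := by rw [hr 1 (fun i _ => by simp only [tmpReg]; omega), h.parN]
  var j := by rw [hr _ (fun i _ => varReg_ne_tmpReg j i), h.var]
  input := by rw [ha, h.input]

/-- A `while` loop counting the register of the variable `j` up to `n`. -/
lemma exec_while {k n : ℕ} {input ρ : ℕ → ℕ} {j T : ℕ} {p : Program}
    (Inv : ℕ → State → Prop)
    (hrep : ∀ i s, Inv i s → Represents k n input (Function.update ρ j i) s)
    (hstep : ∀ i s, i < n → Inv i s → ∃ s' t, Exec p s s' t ∧ t ≤ T ∧ Inv (i + 1) s') :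
    ∀ r i s, i + r = n → Inv i s →
      ∃ s' t, Exec (.whileLt (varReg j) 1 p) s s' t ∧ t ≤ r * (T + 1) + 1 ∧ Inv n s' := by
  intro r
  induction r with
  | zero =>
    intro i s hi h
    obtain rfl : i = n := by omega
    refine ⟨s, 1, .whileFalse ?_, by omega, h⟩
    rw [(hrep _ _ h).parN, (hrep _ _ h).var]
    simp
  | succ r ih =>
    intro i s hi h
    obtain ⟨s₁, t₁, h₁, ht₁, hI⟩ := hstep i s (by omega) h
    obtain ⟨s₂, t₂, h₂, ht₂, hI₂⟩ := ih (i + 1) s₁ (by omega) hI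
    refine ⟨s₂, t₁ + t₂ + 1, .whileTrue ?_ h₁ h₂, ?_, hI₂⟩
    · rw [(hrep _ _ h).parN, (hrep _ _ h).var]
      simp only [Function.update_self]; omega
    · rw [Nat.succ_mul]; omega

/-- The last clause is the frame condition that drives the induction: an operand stored in scratch
register `d` survives the evaluation of the next one from `d + 1` on, and the variable of a sum has
its old value again at the end. Every loop has exactly `n` rounds, so the time bound does not
involve `k`. -/
theorem Ex.exec_compile (k n : ℕ) (input : ℕ → ℕ) (e : Ex) :
    ∀ (d : ℕ) (ρ : ℕ → ℕ) (s : State), Represents k n input ρ s →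
      ∃ s' t, Exec (e.compile d) s s' t ∧ t ≤ e.time.eval n ∧
        s'.reg (tmpReg d) = e.eval k n input ρ ∧ s'.arr = s.arr ∧
        ∀ x, (∀ i, d ≤ i → x ≠ tmpReg i) → s'.reg x = s.reg x := by
  induction e with
  | parK =>
    intro d ρ s h
    refine ⟨_, _, .copy .., by simp [time], by simp [State.setReg, eval, h.parK], rfl, ?_⟩
    intro x hx
    simp [State.setReg, hx d le_rfl]
  | parN =>
    intro d ρ s h
    refine ⟨_, _, .copy .., by simp [time], by simp [State.setReg, eval, h.parN], rfl, ?_⟩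
    intro x hx
    simp [State.setReg, hx d le_rfl]
  | var j =>
    intro d ρ s h
    refine ⟨_, _, .copy .., by simp [time], by simp [State.setReg, eval, h.var], rfl, ?_⟩
    intro x hx
    simp [State.setReg, hx d le_rfl]
  | lit c =>
    intro d ρ s h
    refine ⟨_, _, .const .., by simp [time], by simp [State.setReg, eval], rfl, ?_⟩
    intro x hx
    simp [State.setReg, hx d le_rfl]
  | add a b iha ihb =>
    intro d ρ s h
    obtain ⟨s₁, t₁, e₁, ht₁, v₁, a₁, r₁⟩ := iha d ρ s h
    obtain ⟨s₂, t₂, e₂, ht₂, v₂, a₂, r₂⟩ := ihb (d + 1) ρ s₁ (h.congr r₁ (by rw [a₁]))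
    refine ⟨_, _, .seq e₁ (.seq e₂ (.add ..)), ?_, ?_, ?_, ?_⟩
    · simp only [time, Polynomial.eval_add, Polynomial.eval_one]; omega
    · have : s₂.reg (tmpReg d) = s₁.reg (tmpReg d) :=
        r₂ _ fun i hi => by rw [Ne, tmpReg_inj]; omega
      simp [State.setReg, eval, v₂, this, v₁]
    · simp [State.setReg, a₂, a₁]
    · intro x hx
      simp [State.setReg, hx d le_rfl, r₂ x (fun i hi => hx i (by omega)), r₁ x hx]
  | sub a b iha ihb =>
    intro d ρ s h
    obtain ⟨s₁, t₁, e₁, ht₁, v₁, a₁, r₁⟩ := iha d ρ s h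
    obtain ⟨s₂, t₂, e₂, ht₂, v₂, a₂, r₂⟩ := ihb (d + 1) ρ s₁ (h.congr r₁ (by rw [a₁]))
    refine ⟨_, _, .seq e₁ (.seq e₂ (.sub ..)), ?_, ?_, ?_, ?_⟩
    · simp only [time, Polynomial.eval_add, Polynomial.eval_one]; omega
    · have : s₂.reg (tmpReg d) = s₁.reg (tmpReg d) :=
        r₂ _ fun i hi => by rw [Ne, tmpReg_inj]; omega
      simp [State.setReg, eval, v₂, this, v₁]
    · simp [State.setReg, a₂, a₁]
    · intro x hx
      simp [State.setReg, hx d le_rfl, r₂ x (fun i hi => hx i (by omega)), r₁ x hx]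
  | load a iha =>
    intro d ρ s h
    obtain ⟨s₁, t₁, e₁, ht₁, v₁, a₁, r₁⟩ := iha d ρ s h
    refine ⟨_, _, .seq e₁ (.load ..), ?_, ?_, ?_, ?_⟩
    · simp only [time, Polynomial.eval_add, Polynomial.eval_one]; omega
    · simp [State.setReg, eval, v₁, a₁, h.input]
    · simp [State.setReg, a₁]
    · intro x hx
      simp [State.setReg, hx d le_rfl, r₁ x hx]
  | ite a b p q iha ihb ihp ihq =>
    intro d ρ s h
    obtain ⟨s₁, t₁, e₁, ht₁, v₁, a₁, r₁⟩ := iha d ρ s h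
    have h₁ := h.congr r₁ (by rw [a₁])
    obtain ⟨s₂, t₂, e₂, ht₂, v₂, a₂, r₂⟩ := ihb (d + 1) ρ s₁ h₁
    have h₂ := h₁.congr r₂ (by rw [a₂])
    have h12 : s₂.reg (tmpReg d) = s₁.reg (tmpReg d) :=
      r₂ _ fun i hi => by rw [Ne, tmpReg_inj]; omega
    by_cases hlt : a.eval k n input ρ < b.eval k n input ρ
    · obtain ⟨s₃, t₃, e₃, ht₃, v₃, a₃, r₃⟩ := ihp d ρ s₂ h₂
      refine ⟨_, _, .seq e₁ (.seq e₂ (.ifTrue (by rwa [v₂, h12, v₁]) e₃)), ?_, ?_, ?_, ?_⟩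
      · simp only [time, Polynomial.eval_add, Polynomial.eval_one]; omega
      · simp [eval, hlt, v₃]
      · rw [a₃, a₂, a₁]
      · intro x hx
        rw [r₃ x hx, r₂ x (fun i hi => hx i (by omega)), r₁ x hx]
    · obtain ⟨s₃, t₃, e₃, ht₃, v₃, a₃, r₃⟩ := ihq d ρ s₂ h₂
      refine ⟨_, _, .seq e₁ (.seq e₂ (.ifFalse (by rwa [v₂, h12, v₁]) e₃)), ?_, ?_, ?_, ?_⟩
      · simp only [time, Polynomial.eval_add, Polynomial.eval_one]; omega
      · simp [eval, hlt, v₃]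
      · rw [a₃, a₂, a₁]
      · intro x hx
        rw [r₃ x hx, r₂ x (fun i hi => hx i (by omega)), r₁ x hx]
  | sum j a iha =>
    intro d ρ s h
    -- The register of `j` is exempt from the frame clause; its saved value in scratch register `d +
    -- 1` is copied back after the loop.
    let Inv : ℕ → State → Prop := fun i s' =>
      Represents k n input (Function.update ρ j i) s' ∧
      s'.reg (tmpReg d) = ∑ l ∈ Finset.range i, a.eval k n input (Function.update ρ j l) ∧
      s'.reg (tmpReg (d + 1)) = ρ j ∧ s'.reg (tmpReg (d + 2)) = 1 ∧ s'.arr = s.arr ∧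
      ∀ x, x ≠ varReg j → (∀ i, d ≤ i → x ≠ tmpReg i) → s'.reg x = s.reg x
    obtain ⟨s₂, t₂, e₂, ht₂, hI₂, v₂, o₂, -, a₂, r₂⟩ := exec_while (k := k) (n := n)
      (input := input) (ρ := ρ) (j := j) (T := a.time.eval n + 2)
      (p := .seq (a.compile (d + 3)) <| .seq (.add (tmpReg d) (tmpReg d) (tmpReg (d + 3))) <|
        .add (varReg j) (varReg j) (tmpReg (d + 2))) Inv (fun i s hi => hi.1) (by
        rintro i s₁ hi ⟨hr, hv, ho, h1, ha, hx⟩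
        obtain ⟨s₂, t₂, e₂, ht₂, v₂, a₂, r₂⟩ := iha (d + 3) _ s₁ hr
        have hd : ∀ l, l < 3 → s₂.reg (tmpReg (d + l)) = s₁.reg (tmpReg (d + l)) := fun l hl =>
          r₂ _ fun i hi => by rw [Ne, tmpReg_inj]; omega
        have hd0 := hd 0 (by omega)
        have hd1 := hd 1 (by omega)
        have hd2 := hd 2 (by omega)
        have hvar : ∀ l, s₂.reg (varReg l) = Function.update ρ j i l := fun l => by
          rw [r₂ _ fun i hi => varReg_ne_tmpReg l i, hr.var]
        simp only [add_zero] at hd0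
        have n1 : ∀ l i, tmpReg l ≠ varReg i := fun l i => (varReg_ne_tmpReg i l).symm
        refine ⟨_, _, .seq e₂ (.seq (.add ..) (.add ..)), by omega, ⟨?_, ?_, ?_, ?_⟩, ?_, ?_, ?_,
          ?_, ?_⟩
        · rw [← hr.parK, ← r₂ 0 (fun i hi => by simp only [tmpReg]; omega)]
          simp [State.setReg, Function.update_apply, varReg, tmpReg]
        · rw [← hr.parN, ← r₂ 1 (fun i hi => by simp only [tmpReg]; omega)]
          simp [State.setReg, Function.update_apply, varReg, tmpReg]
        · intro l
          by_cases hl : l = j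
          · subst hl
            simp [State.setReg, tmpReg_inj, varReg_ne_tmpReg, hvar, hd2, h1]
          · simp [State.setReg, Function.update_apply, varReg_inj, varReg_ne_tmpReg, hvar, hl]
        · simp [State.setReg, a₂, hr.input]
        · simp [State.setReg, Function.update_apply, n1, hd0, hv, v₂,
            Finset.sum_range_succ]
        · simp [State.setReg, Function.update_apply, n1, tmpReg_inj, hd1, ho]
        · simp [State.setReg, Function.update_apply, n1, tmpReg_inj, hd2, h1]
        · simp [State.setReg, a₂, ha]
        · intro x hxj hxt
          simp [State.setReg, Function.update_apply, hxj, hxt d le_rfl,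
            r₂ x (fun i hi => hxt i (by omega)), hx x hxj hxt]) n 0
      ((((s.setReg (tmpReg (d + 1)) (s.reg (varReg j))).setReg (tmpReg d) 0).setReg (varReg j)
        0).setReg (tmpReg (d + 2)) 1) (by omega) (by
        have n1 : ∀ l i, tmpReg l ≠ varReg i := fun l i => (varReg_ne_tmpReg i l).symm
        refine ⟨⟨?_, ?_, ?_, ?_⟩, ?_, ?_, ?_, ?_, ?_⟩
        · rw [← h.parK]
          simp [State.setReg, varReg, tmpReg]
        · rw [← h.parN]
          simp [State.setReg, varReg, tmpReg]
        · intro l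
          simp [State.setReg, Function.update_apply, varReg_inj, varReg_ne_tmpReg, h.var]
        · simp [State.setReg, h.input]
        · simp [State.setReg, n1, tmpReg_inj]
        · simp [State.setReg, n1, tmpReg_inj, h.var]
        · simp [State.setReg]
        · simp [State.setReg]
        · intro x hxj hxt
          simp [State.setReg, hxj, hxt d le_rfl, hxt (d + 1) (by omega),
            hxt (d + 2) (by omega)])
    refine ⟨_, _, .seq (.copy ..) <| .seq (.const ..) <| .seq (.const ..) <| .seq (.const ..) <|
      .seq e₂ (.copy ..), ?_, ?_, ?_, ?_⟩
    · simp only [time, Polynomial.eval_add, Polynomial.eval_mul, Polynomial.eval_X,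
        Polynomial.eval_ofNat]
      have : (a.time.eval n + 2 + 1) = a.time.eval n + 3 := rfl
      rw [this] at ht₂
      omega
    · simp [State.setReg, (varReg_ne_tmpReg j d).symm, v₂, eval]
    · simp [State.setReg, a₂]
    · intro x hx
      by_cases hxj : x = varReg j
      · subst hxj
        simp [State.setReg, o₂, h.var]
      · simp [State.setReg, hxj, r₂ x hxj hx]

/-! ## Output statements -/

/-- Statements writing to the arrays other than the input array. -/
inductive Stmt : Type
  /-- cell `i` of array `a + 1` becomes `e` -/
  | store (a : ℕ) (i e : Ex)
  /-- for all values of the variable `j` below `n` in increasing order, do `p` -/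
  | loop (j : ℕ) (p : Stmt)
  | seq (p q : Stmt)

/-- The effect of a statement on the arrays. -/
def Stmt.eval (k n : ℕ) (input : ℕ → ℕ) : Stmt → (ℕ → ℕ) → (ℕ → ℕ → ℕ) → (ℕ → ℕ → ℕ)
  | .store a i e, ρ, A => Function.update A (a + 1)
      (Function.update (A (a + 1)) (i.eval k n input ρ) (e.eval k n input ρ))
  | .loop j p, ρ, A => Nat.rec A (fun i B => p.eval k n input (Function.update ρ j i) B) n
  | .seq p q, ρ, A => q.eval k n input ρ (p.eval k n input ρ A)

/-- The program executing a statement, using only scratch registers from `d` on. -/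
def Stmt.compile : Stmt → ℕ → Program
  | .store a i e, d =>
      .seq (i.compile d) (.seq (e.compile (d + 1)) (.store (a + 1) (tmpReg d) (tmpReg (d + 1))))
  | .loop j p, d =>
      .seq (.copy (tmpReg d) (varReg j)) <|
      .seq (.const (varReg j) 0) <|
      .seq (.const (tmpReg (d + 1)) 1) <|
      .seq (.whileLt (varReg j) 1 <|
        .seq (p.compile (d + 2)) (.add (varReg j) (varReg j) (tmpReg (d + 1)))) <|
      .copy (varReg j) (tmpReg d)
  | .seq p q, d => .seq (p.compile d) (q.compile d)

/-- A bound on the execution time, as a polynomial in `n`. -/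
noncomputable def Stmt.time : Stmt → Polynomial ℕ
  | .store _ i e => i.time + e.time + 1
  | .loop _ p => Polynomial.X * (p.time + 2) + 5
  | .seq p q => p.time + q.time

/-- Stores address arrays `a + 1` only, so later expressions still read the original input. -/
lemma Stmt.eval_zero (k n : ℕ) (input : ℕ → ℕ) (p : Stmt) :
    ∀ (ρ : ℕ → ℕ) (A : ℕ → ℕ → ℕ), p.eval k n input ρ A 0 = A 0 := by
  induction p with
  | store a i e => intro ρ A; simp [eval]
  | loop j p ih =>
    intro ρ A
    have : ∀ r, (Nat.rec A (fun i B => p.eval k n input (Function.update ρ j i) B) r :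
        ℕ → ℕ → ℕ) 0 = A 0 := by
      intro r
      induction r with
      | zero => rfl
      | succ r ihr => rw [← ihr]; exact ih _ _
    exact this n
  | seq p q ihp ihq => intro ρ A; simp [eval, ihp, ihq]

theorem Stmt.exec_compile (k n : ℕ) (input : ℕ → ℕ) (p : Stmt) :
    ∀ (d : ℕ) (ρ : ℕ → ℕ) (s : State), Represents k n input ρ s →
      ∃ s' t, Exec (p.compile d) s s' t ∧ t ≤ p.time.eval n ∧
        s'.arr = p.eval k n input ρ s.arr ∧
        ∀ x, (∀ i, d ≤ i → x ≠ tmpReg i) → s'.reg x = s.reg x := by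
  induction p with
  | store a i e =>
    intro d ρ s h
    obtain ⟨s₁, t₁, e₁, ht₁, v₁, a₁, r₁⟩ := i.exec_compile k n input d ρ s h
    obtain ⟨s₂, t₂, e₂, ht₂, v₂, a₂, r₂⟩ :=
      e.exec_compile k n input (d + 1) ρ s₁ (h.congr r₁ (by rw [a₁]))
    refine ⟨_, _, .seq e₁ (.seq e₂ (.store ..)), ?_, ?_, ?_⟩
    · simp only [time, Polynomial.eval_add, Polynomial.eval_one]; omega
    · have : s₂.reg (tmpReg d) = s₁.reg (tmpReg d) :=
        r₂ _ fun i hi => by rw [Ne, tmpReg_inj]; omega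
      simp [State.setArr, eval, v₂, this, v₁, a₂, a₁]
    · intro x hx
      simp [State.setArr, r₂ x (fun i hi => hx i (by omega)), r₁ x hx]
  | seq p q ihp ihq =>
    intro d ρ s h
    obtain ⟨s₁, t₁, e₁, ht₁, a₁, r₁⟩ := ihp d ρ s h
    obtain ⟨s₂, t₂, e₂, ht₂, a₂, r₂⟩ := ihq d ρ s₁ (h.congr r₁ (by rw [a₁, eval_zero]))
    refine ⟨_, _, .seq e₁ e₂, ?_, ?_, ?_⟩
    · simp only [time, Polynomial.eval_add]; omega
    · rw [a₂, a₁, eval]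
    · intro x hx
      rw [r₂ x hx, r₁ x hx]
  | loop j p ih =>
    intro d ρ s h
    let Inv : ℕ → State → Prop := fun i s' =>
      Represents k n input (Function.update ρ j i) s' ∧
      s'.arr = Nat.rec s.arr (fun i B => p.eval k n input (Function.update ρ j i) B) i ∧
      s'.reg (tmpReg d) = ρ j ∧ s'.reg (tmpReg (d + 1)) = 1 ∧
      ∀ x, x ≠ varReg j → (∀ i, d ≤ i → x ≠ tmpReg i) → s'.reg x = s.reg x
    obtain ⟨s₂, t₂, e₂, ht₂, hI₂, a₂, o₂, -, r₂⟩ := exec_while (k := k) (n := n)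
      (input := input) (ρ := ρ) (j := j) (T := p.time.eval n + 1)
      (p := .seq (p.compile (d + 2)) (.add (varReg j) (varReg j) (tmpReg (d + 1))))
      Inv (fun i s hi => hi.1) (by
        rintro i s₁ hi ⟨hr, ha, ho, h1, hx⟩
        obtain ⟨s₂, t₂, e₂, ht₂, a₂, r₂⟩ := ih (d + 2) _ s₁ hr
        have hd : ∀ l, l < 2 → s₂.reg (tmpReg (d + l)) = s₁.reg (tmpReg (d + l)) := fun l hl =>
          r₂ _ fun i hi => by rw [Ne, tmpReg_inj]; omega
        have hd0 := hd 0 (by omega)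
        have hd1 := hd 1 (by omega)
        have hvar : ∀ l, s₂.reg (varReg l) = Function.update ρ j i l := fun l => by
          rw [r₂ _ fun i hi => varReg_ne_tmpReg l i, hr.var]
        simp only [add_zero] at hd0
        have n1 : ∀ l i, tmpReg l ≠ varReg i := fun l i => (varReg_ne_tmpReg i l).symm
        refine ⟨_, _, .seq e₂ (.add ..), by omega, ⟨?_, ?_, ?_, ?_⟩, ?_, ?_, ?_, ?_⟩
        · rw [← hr.parK, ← r₂ 0 (fun i hi => by simp only [tmpReg]; omega)]
          simp [State.setReg, varReg]
        · rw [← hr.parN, ← r₂ 1 (fun i hi => by simp only [tmpReg]; omega)]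
          simp [State.setReg, varReg]
        · intro l
          by_cases hl : l = j
          · subst hl
            simp [State.setReg, hvar, hd1, h1]
          · simp [State.setReg, varReg_inj, hvar, hl]
        · simp [State.setReg, a₂, eval_zero, hr.input]
        · simp only [State.setReg, a₂, ha]
        · simp [State.setReg, n1, hd0, ho]
        · simp [State.setReg, n1, hd1, h1]
        · intro x hxj hxt
          simp [State.setReg, hxj,
            r₂ x (fun i hi => hxt i (by omega)), hx x hxj hxt]) n 0
      (((s.setReg (tmpReg d) (s.reg (varReg j))).setReg (varReg j) 0).setReg (tmpReg (d + 1)) 1)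
      (by omega) (by
        have n1 : ∀ l i, tmpReg l ≠ varReg i := fun l i => (varReg_ne_tmpReg i l).symm
        refine ⟨⟨?_, ?_, ?_, ?_⟩, ?_, ?_, ?_, ?_⟩
        · rw [← h.parK]
          simp [State.setReg, varReg, tmpReg]
        · rw [← h.parN]
          simp [State.setReg, varReg, tmpReg]
        · intro l
          simp [State.setReg, Function.update_apply, varReg_inj, varReg_ne_tmpReg, h.var]
        · simp [State.setReg, h.input]
        · simp [State.setReg]
        · simp [State.setReg, n1, tmpReg_inj, h.var]
        · simp [State.setReg]
        · intro x hxj hxt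
          simp [State.setReg, hxj, hxt d le_rfl, hxt (d + 1) (by omega)])
    refine ⟨_, _, .seq (.copy ..) <| .seq (.const ..) <| .seq (.const ..) <|
      .seq e₂ (.copy ..), ?_, ?_, ?_⟩
    · simp only [time, Polynomial.eval_add, Polynomial.eval_mul, Polynomial.eval_X,
        Polynomial.eval_ofNat]
      have : (p.time.eval n + 1 + 1) = p.time.eval n + 2 := rfl
      rw [this] at ht₂
      omega
    · simp only [State.setReg, a₂, eval]
    · intro x hx
      by_cases hxj : x = varReg j
      · subst hxj
        simp [State.setReg, o₂, h.var]
      · simp [State.setReg, hxj, r₂ x hxj hx]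

end ChromaticCC

namespace ChromaticCC

/-! ## Preclusters

Throughout, `f u v` is the code of the pair `(u, v)`: zero for a `-` edge, and otherwise the code of
the color of the `+` edge. -/

open Classical Finset

section Preclusters

variable {V : Type} [Fintype V] (f : V → V → ℕ)

/-- The closed neighborhood in the graph of `+` edges. -/
noncomputable def nbhd (u : V) : Finset V := {w | w = u ∨ f u w ≠ 0}

/-- The vertices `w` for which the triangle `u v w` forces a disagreement at `w` if the `+` edge
`u v` agrees. -/
noncomputable def conflicts (u v : V) : Finset V :=
  {w | w ≠ u ∧ w ≠ v ∧ ¬ (f u w = f v w ∧ (f u w = 0 ∨ f u w = f u v))}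

/-- A `+` edge with few conflicts. -/
def Good (u v : V) : Prop :=
  f u v ≠ 0 ∧ 1000 * #(conflicts f u v) ≤ #(nbhd f u) + #(nbhd f v)

/-- The neighbors of `u` along `+` edges that are not good. -/
noncomputable def bad (u : V) : Finset V := {v | f u v ≠ 0 ∧ ¬ Good f u v}

/-- Most `+` edges at `u` are good. -/
def Heavy (u : V) : Prop := 10 * #(bad f u) + 1 < #(nbhd f u)

/-- `w` is `u` or a neighbor along a good edge. -/
def Near (u w : V) : Prop := w = u ∨ Good f u w

/-- Heavy vertices are linked if they have a common good neighbor. -/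
def Linked (u v : V) : Prop :=
  u = v ∨ Heavy f u ∧ Heavy f v ∧ ∃ w, Near f u w ∧ Near f v w

/-- The vertices linked to `u`. -/
noncomputable def cls (u : V) : Finset V := {v | Linked f u v}

/-- No vertex of the class of `u` has many neighbors outside the class. -/
def Kept (u : V) : Prop := ∀ v, Linked f u v → 60 * #(nbhd f v \ cls f v) ≤ #(cls f v)

/-- `u` and `v` lie in the same precluster. -/
def Same (u v : V) : Prop := u = v ∨ Linked f u v ∧ Kept f u

/-- The common neighbors of `u` and `v` whose degree is bounded in terms of `c`. -/
noncomputable def common (k : ℕ) (u v : V) (c : ℕ) : Finset V :=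
  {w | w ∈ nbhd f u ∧ w ∈ nbhd f v ∧ #(nbhd f w) ≤ (k + 2) * c}

/-- `u v` is an admissible edge. -/
def Adm (k : ℕ) (u v : V) : Prop :=
  ¬ Same f u v ∧ ∃ c, 1 ≤ c ∧ c ≤ Fintype.card V ∧ c ≤ (k + 2) * #(common f k u v c)

/-- The common color of the good edges at `u`. -/
noncomputable def hue (u : V) : ℕ := if h : ∃ w, Good f u w then f u h.choose else 0

/-- The codes of the pairs at `u`, with the diagonal filled by the color of the good edges. -/
noncomputable def row (u w : V) : ℕ := if w = u then hue f u else f u w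

/-- The number of vertices distinguishing `u` from `v`. -/
noncomputable def rowDist (u v : V) : ℕ := #{w | row f u w ≠ row f v w}

variable {f}

/-! ### Membership criteria and the Hamming distance of rows -/

lemma mem_nbhd {u w : V} : w ∈ nbhd f u ↔ w = u ∨ f u w ≠ 0 := by simp [nbhd]

lemma mem_conflicts {u v w : V} : w ∈ conflicts f u v ↔
    w ≠ u ∧ w ≠ v ∧ ¬ (f u w = f v w ∧ (f u w = 0 ∨ f u w = f u v)) := by simp [conflicts]

lemma mem_bad {u v : V} : v ∈ bad f u ↔ f u v ≠ 0 ∧ ¬ Good f u v := by simp [bad]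

lemma mem_cls {u v : V} : v ∈ cls f u ↔ Linked f u v := by simp [cls]

lemma rowDist_comm (u v : V) : rowDist f u v = rowDist f v u := by
  simp only [rowDist, ne_comm]

lemma rowDist_self (u : V) : rowDist f u u = 0 := by simp [rowDist]

lemma rowDist_triangle (u v w : V) : rowDist f u w ≤ rowDist f u v + rowDist f v w := by
  refine (card_le_card ?_).trans (card_union_le _ _)
  intro x
  simp only [mem_filter, mem_univ, true_and, mem_union]
  grind

lemma mem_nbhd_sdiff_cls {u w : V} :
    w ∈ nbhd f u \ cls f u ↔ w ∈ nbhd f u ∧ ¬ Linked f u w := by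
  rw [mem_sdiff, mem_cls]

lemma mem_common {k c : ℕ} {u v w : V} : w ∈ common f k u v c ↔
    w ∈ nbhd f u ∧ w ∈ nbhd f v ∧ #(nbhd f w) ≤ (k + 2) * c := by simp [common]

variable (hs : ∀ u v, f u v = f v u) (h0 : ∀ u, f u u = 0)

include hs

lemma mem_nbhd_comm {u w : V} : w ∈ nbhd f u ↔ u ∈ nbhd f w := by
  rw [mem_nbhd, mem_nbhd, hs u w, eq_comm]

lemma conflicts_comm (u v : V) : conflicts f u v = conflicts f v u := by
  ext w
  simp only [mem_conflicts]
  have := hs u v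
  grind

lemma Good.symm {u v : V} (h : Good f u v) : Good f v u := by
  refine ⟨by rw [hs]; exact h.1, ?_⟩
  rw [conflicts_comm hs, add_comm]
  exact h.2

/-! ### Good edges: colors, rows and neighborhoods -/

omit hs in
lemma card_nbhd_le_add_conflicts {u v : V} (h : f u v ≠ 0) :
    #(nbhd f v) ≤ #(nbhd f u) + #(conflicts f u v) := by
  refine (card_le_card ?_).trans (card_union_le _ _)
  intro x
  simp only [mem_union, mem_nbhd, mem_conflicts]
  grind

include h0

omit hs in
lemma Good.ne {u v : V} (h : Good f u v) : v ≠ u := by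
  rintro rfl
  exact h.1 (h0 v)

omit hs in
-- The edge from `u` to a neighbor has only one color, so that neighbor conflicts with at least one
-- of two differently colored edges at `u`. Two good edges do not have enough conflicts to cover all
-- neighbors.
lemma Good.color_eq {u v w : V} (hv : Good f u v) (hw : Good f u w) : f u v = f u w := by
  by_contra hne
  have h₁ : (nbhd f u).erase u ⊆ conflicts f u v ∪ conflicts f u w := by
    intro x
    simp only [mem_union, mem_nbhd, mem_conflicts, mem_erase]
    grind
  have h₂ := (card_le_card h₁).trans (card_union_le _ _)
  rw [card_erase_of_mem (mem_nbhd.2 (.inl rfl))] at h₂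
  have h₃ : 2 ≤ #(nbhd f u) := by
    rw [← card_pair (hv.ne h0)]
    refine card_le_card ?_
    intro x
    simp only [mem_insert, mem_singleton, mem_nbhd]
    have := hv.1
    grind
  have h₄ := card_nbhd_le_add_conflicts hv.1
  have h₅ := card_nbhd_le_add_conflicts hw.1
  have h₆ := hv.2
  have h₇ := hw.2
  omega

omit hs in
lemma Good.eq_hue {u v : V} (h : Good f u v) : f u v = hue f u := by
  have hex : ∃ w, Good f u w := ⟨v, h⟩
  rw [hue, dif_pos hex]
  exact h.color_eq h0 hex.choose_spec

omit hs in
lemma Good.hue_ne_zero {u v : V} (h : Good f u v) : hue f u ≠ 0 := by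
  rw [← h.eq_hue h0]
  exact h.1

/-- The diagonal of `row` is filled with the color of the good edges exactly so that the two rows
agree at `u` and `v`; at any other vertex a difference is a conflict. -/
lemma Good.rowDist_le {u v : V} (h : Good f u v) : 1000 * rowDist f u v ≤
    #(nbhd f u) + #(nbhd f v) := by
  have : rowDist f u v ≤ #(conflicts f u v) := by
    refine card_le_card ?_
    intro x
    simp only [mem_filter, mem_univ, true_and, mem_conflicts]
    simp only [row]
    have h₁ := h.eq_hue h0
    have h₂ := (h.symm hs).eq_hue h0
    have h₃ := hs u v
    grind
  have := h.2
  omega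

lemma Near.rowDist_le {u w : V} (h : Near f u w) : 1000 * rowDist f u w ≤
    #(nbhd f u) + #(nbhd f w) := by
  rcases h with rfl | h
  · simp [rowDist_self]
  · exact h.rowDist_le hs h0

lemma Near.hue_eq {u w : V} (h : Near f u w) : hue f w = hue f u := by
  rcases h with rfl | h
  · rfl
  · rw [← h.eq_hue h0, ← (h.symm hs).eq_hue h0, hs]

omit hs h0 in
-- With a nonzero diagonal entry the closed neighborhood is the support of the row, so row distance
-- controls differences of neighborhoods and degrees.
lemma mem_nbhd_iff_row {u w : V} (h : hue f u ≠ 0) : w ∈ nbhd f u ↔ row f u w ≠ 0 := by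
  rw [mem_nbhd, row]
  split_ifs with hw <;> simp [hw, h]

omit hs h0 in
lemma card_nbhd_sdiff_le {u v : V} (hu : hue f u ≠ 0) (hv : hue f v ≠ 0) :
    #(nbhd f u \ nbhd f v) ≤ rowDist f u v := by
  refine card_le_card ?_
  intro x
  simp only [mem_sdiff, mem_filter, mem_univ, true_and, mem_nbhd_iff_row hu, mem_nbhd_iff_row hv]
  grind

omit hs h0 in
lemma card_nbhd_le {u v : V} (hu : hue f u ≠ 0) (hv : hue f v ≠ 0) :
    #(nbhd f u) ≤ #(nbhd f v) + rowDist f u v := by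
  have := card_nbhd_sdiff_le hu hv
  have := card_le_card_sdiff_add_card (s := nbhd f u) (t := nbhd f v)
  omega

omit hs h0 in
lemma card_nbhd_le_near (u : V) : #(nbhd f u) ≤ #{w | Near f u w} + #(bad f u) := by
  refine (card_le_card ?_).trans (card_union_le _ _)
  intro x
  simp only [mem_union, mem_filter, mem_univ, true_and, mem_nbhd, mem_bad]
  simp only [Near]
  tauto

omit hs h0 in
lemma Near.mem_nbhd {u w : V} (h : Near f u w) : w ∈ nbhd f u := by
  rw [ChromaticCC.mem_nbhd]
  exact h.imp_right fun h => h.1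

omit hs h0 in
-- The `+ 1` in `Heavy` accounts for `u` itself in its closed neighborhood.
lemma Heavy.exists_good {u : V} (h : Heavy f u) : ∃ w, Good f u w := by
  by_contra! hn
  have h₁ : #{w | Near f u w} ≤ 1 := by
    rw [card_le_one_iff]
    simp only [Near, hn, or_false, mem_filter, mem_univ, true_and]
    grind
  have := card_nbhd_le_near (f := f) u
  have h₂ : 10 * #(bad f u) + 1 < #(nbhd f u) := h
  omega

omit hs in
lemma Heavy.hue_ne_zero {u : V} (h : Heavy f u) : hue f u ≠ 0 :=
  h.exists_good.choose_spec.hue_ne_zero h0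

/-! ### Linkage and common preclusters are equivalence relations -/

omit hs h0 in
lemma Linked.refl (u : V) : Linked f u u := .inl rfl

omit hs h0 in
lemma Linked.symm {u v : V} (h : Linked f u v) : Linked f v u := by
  rcases h with rfl | ⟨hu, hv, w, h₁, h₂⟩
  · exact .inl rfl
  · exact .inr ⟨hv, hu, w, h₂, h₁⟩

lemma Linked.hue_eq {u v : V} (h : Linked f u v) : hue f u = hue f v := by
  rcases h with rfl | ⟨-, -, w, h₁, h₂⟩
  · rfl
  · rw [← h₁.hue_eq hs h0, h₂.hue_eq hs h0]

/-- Go through the common near vertex: each leg costs about 2/1000 of the degree, the degrees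
involved being nearly equal, and 1/200 leaves room for the error. -/
lemma Linked.rowDist_le {u v : V} (h : Linked f u v) : 200 * rowDist f u v ≤ #(nbhd f u) := by
  rcases h with rfl | ⟨hu, hv, w, h₁, h₂⟩
  · simp [rowDist_self]
  · have hu₀ := hu.hue_ne_zero h0
    have hv₀ := hv.hue_ne_zero h0
    have hw₀ : hue f w ≠ 0 := by rwa [h₁.hue_eq hs h0]
    have a₁ := h₁.rowDist_le hs h0
    have a₂ := h₂.rowDist_le hs h0
    have a₃ := rowDist_triangle (f := f) u w v
    have a₄ := rowDist_comm (f := f) w v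
    have a₅ := rowDist_comm (f := f) w u
    have a₆ := card_nbhd_le hw₀ hu₀
    have a₇ := card_nbhd_le hv₀ hw₀
    omega

/-- If `u` and `x` had no common near vertex, each vertex of `nbhd f u` would be bad for `u`, bad
for `x`, or outside `nbhd f x`. By heaviness and closeness of the rows these are only about 1/10 +
1/10 + 1/100 of the neighborhood. -/
lemma Linked.trans {u v x : V} (h : Linked f u v) (h' : Linked f v x) : Linked f u x := by
  have d₁ := h.rowDist_le hs h0
  have d₂ := h'.symm.rowDist_le hs h0
  rcases h with rfl | ⟨hu, hv, hw⟩
  · exact h'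
  rcases h' with rfl | ⟨-, hx, -⟩
  · exact .inr ⟨hu, hv, hw⟩
  clear hw
  refine .inr ⟨hu, hx, ?_⟩
  by_contra! hn
  have hu₀ := hu.hue_ne_zero h0
  have hx₀ := hx.hue_ne_zero h0
  have h₁ : nbhd f u ⊆ (bad f u ∪ bad f x) ∪ (nbhd f u \ nbhd f x) := by
    intro w hw
    have := hn w
    have hwu := ChromaticCC.mem_nbhd.1 hw
    by_cases hwx : w ∈ nbhd f x
    · have hwx' := ChromaticCC.mem_nbhd.1 hwx
      simp only [mem_union, mem_bad]
      simp only [Near] at this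
      tauto
    · simp [hw, hwx]
  have h₂ := (card_le_card h₁).trans (card_union_le _ _)
  have h₃ := card_union_le (bad f u) (bad f x)
  have h₄ := card_nbhd_sdiff_le hu₀ hx₀
  have h₅ := card_nbhd_le hx₀ hu₀
  have h₆ := rowDist_triangle (f := f) u v x
  have h₇ := rowDist_comm (f := f) x v
  have h₈ := rowDist_comm (f := f) x u
  have h₉ : 10 * #(bad f u) + 1 < #(nbhd f u) := hu
  have h₁₀ : 10 * #(bad f x) + 1 < #(nbhd f x) := hx
  omega

lemma Linked.cls_eq {u v : V} (h : Linked f u v) : cls f u = cls f v := by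
  ext w
  rw [mem_cls, mem_cls]
  exact ⟨fun hw => h.symm.trans hs h0 hw, fun hw => h.trans hs h0 hw⟩

lemma Kept.congr {u v : V} (h : Linked f u v) (hk : Kept f u) : Kept f v :=
  fun w hw => hk w (h.trans hs h0 hw)

omit hs h0 in
lemma Same.refl (u : V) : Same f u u := .inl rfl

lemma Same.symm {u v : V} (h : Same f u v) : Same f v u := by
  rcases h with rfl | ⟨h, hk⟩
  · exact .inl rfl
  · exact .inr ⟨h.symm, hk.congr hs h0 h⟩

lemma Same.trans {u v w : V} (h : Same f u v) (h' : Same f v w) : Same f u w := by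
  rcases h with rfl | ⟨h, hk⟩
  · exact h'
  rcases h' with rfl | ⟨h', -⟩
  · exact .inr ⟨h, hk⟩
  · exact .inr ⟨h.trans hs h0 h', hk⟩

lemma Adm.symm {k : ℕ} {u v : V} (h : Adm f k u v) : Adm f k v u := by
  obtain ⟨h₁, c, h₂, h₃, h₄⟩ := h
  refine ⟨fun h => h₁ (h.symm hs h0), c, h₂, h₃, ?_⟩
  refine h₄.trans (Nat.mul_le_mul_left _ (card_le_card fun w => ?_))
  simp only [mem_common]
  tauto

/-! ### The number of `+` edges between preclusters -/

omit h0 in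
/-- The `+` edges that are not good are charged to the disagreements of any solution. -/
lemma sum_bad_le {dis : V → V → Prop}
    (hd : ∀ u v w, f u v ≠ 0 → ¬ dis u v → w ∈ conflicts f u v → dis u w ∨ dis v w) :
    ∑ u, #(bad f u) ≤ 2001 * ∑ u, #{v | dis u v} := by
  set D : V → ℕ := fun u => #{v | dis u v} with hD
  have hpos : ∀ u, (0 : ℝ) < #(nbhd f u) := fun u => by
    exact_mod_cast card_pos.2 ⟨u, mem_nbhd.2 (.inl rfl)⟩
  -- Each vertex `u` pays `1000 * D u / #(nbhd f u)` to each of its bad edges. If a bad edge agrees,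
  -- its conflicts give `#(nbhd f u) + #(nbhd f v) < 1000 * (D u + D v)`, so one of its ends pays at
  -- least 1.
  have key : ∀ u v, (if v ∈ bad f u then (1 : ℝ) else 0) ≤ (if dis u v then 1 else 0) +
      ((if v ∈ bad f u then 1000 * (D u : ℝ) / #(nbhd f u) else 0) +
      (if u ∈ bad f v then 1000 * (D v : ℝ) / #(nbhd f v) else 0)) := by
    intro u v
    have hb : u ∈ bad f v ↔ v ∈ bad f u := by
      rw [mem_bad, mem_bad, hs v u]
      exact and_congr_right fun _ => not_congr ⟨fun h => h.symm hs, fun h => h.symm hs⟩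
    have n₁ : (0 : ℝ) ≤ 1000 * D u / #(nbhd f u) := by positivity
    have n₂ : (0 : ℝ) ≤ 1000 * D v / #(nbhd f v) := by positivity
    by_cases hv : v ∈ bad f u
    · simp only [hv, hb, if_true]
      by_cases hdv : dis u v
      · simp only [hdv, if_true]
        linarith
      · simp only [hdv, if_false, zero_add]
        rw [mem_bad] at hv
        have hng : #(nbhd f u) + #(nbhd f v) < 1000 * #(conflicts f u v) := by
          by_contra hle
          exact hv.2 ⟨hv.1, by omega⟩
        have hc : #(conflicts f u v) ≤ D u + D v := by
          refine (card_le_card ?_).trans (card_union_le _ _)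
          intro w hw
          have := hd u v w hv.1 hdv hw
          simpa [mem_union] using this
        have hlt : (#(nbhd f u) : ℝ) + #(nbhd f v) < 1000 * D u + 1000 * D v := by
          have : #(nbhd f u) + #(nbhd f v) < 1000 * D u + 1000 * D v := by omega
          exact_mod_cast this
        by_contra! hcon
        have q₁ : 1000 * (D u : ℝ) / #(nbhd f u) < 1 := by linarith
        have q₂ : 1000 * (D v : ℝ) / #(nbhd f v) < 1 := by linarith
        rw [div_lt_one (hpos u)] at q₁
        rw [div_lt_one (hpos v)] at q₂
        linarith
    · simp only [hv, hb, if_false]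
      split_ifs <;> norm_num
  have hsum := sum_le_sum fun u (_ : u ∈ univ) => sum_le_sum fun v (_ : v ∈ univ) => key u v
  simp only [sum_add_distrib] at hsum
  -- No vertex pays more than `1000 * D u` in all; both ends pay, whence 2001 = 1 + 1000 + 1000.
  have e₁ : ∀ u, ∑ v, (if v ∈ bad f u then 1000 * (D u : ℝ) / #(nbhd f u) else 0) ≤
      1000 * D u := by
    intro u
    rw [← sum_filter, filter_univ_mem, sum_const, nsmul_eq_mul, mul_div_assoc', div_le_iff₀ (hpos u),
      mul_comm]
    have : (#(bad f u) : ℝ) ≤ #(nbhd f u) := by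
      refine Nat.cast_le.2 (card_le_card fun w hw => mem_nbhd.2 (.inr (mem_bad.1 hw).1))
    gcongr
  have e₂ : ∑ u, ∑ v, (if u ∈ bad f v then 1000 * (D v : ℝ) / #(nbhd f v) else 0) ≤
      ∑ u, 1000 * (D u : ℝ) := by
    rw [sum_comm]
    exact sum_le_sum fun u _ => e₁ u
  have e₃ := sum_le_sum fun u (_ : u ∈ univ) => e₁ u
  have e₄ : ∑ u, ∑ v, (if v ∈ bad f u then (1 : ℝ) else 0) = ((∑ u, #(bad f u) : ℕ) : ℝ) := by
    push_cast
    refine sum_congr rfl fun u _ => ?_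
    rw [← sum_filter, filter_univ_mem, sum_const, nsmul_eq_mul, mul_one]
  have e₅ : ∑ u, ∑ v, (if dis u v then (1 : ℝ) else 0) = ((∑ u, D u : ℕ) : ℝ) := by
    push_cast
    refine sum_congr rfl fun u _ => ?_
    simp [hD]
  have e₆ : ∑ u, 1000 * (D u : ℝ) = 1000 * ((∑ u, D u : ℕ) : ℝ) := by
    push_cast
    rw [mul_sum]
  rw [e₄, e₅] at hsum
  rw [e₆] at e₂ e₃
  have : ((∑ u, #(bad f u) : ℕ) : ℝ) ≤ 2001 * ((∑ u, D u : ℕ) : ℝ) := by linarith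
  exact_mod_cast this

/-- The number of `+` edges between different classes. -/
lemma sum_not_linked_le :
    ∑ u, #{v | f u v ≠ 0 ∧ ¬ Linked f u v} ≤ 21 * ∑ u, #(bad f u) := by
  -- A good edge between heavy vertices links them, its end `v` being near both. The other edges are
  -- bad or have a light end, and a light vertex has at most 10 times as many `+` edges as bad ones:
  -- 21 = 1 + 10 + 10.
  have key : ∀ u v, (if f u v ≠ 0 ∧ ¬ Linked f u v then 1 else 0) ≤
      (if v ∈ bad f u then 1 else 0) + ((if f u v ≠ 0 ∧ ¬ Heavy f u then 1 else 0) +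
      (if f v u ≠ 0 ∧ ¬ Heavy f v then 1 else 0)) := by
    intro u v
    by_cases h : f u v ≠ 0 ∧ ¬ Linked f u v
    · rw [if_pos h]
      have hv : v ∈ bad f u ∨ ¬ Heavy f u ∨ ¬ Heavy f v := by
        by_contra! hcon
        obtain ⟨h₁, h₂, h₃⟩ := hcon
        rw [mem_bad] at h₁
        refine h.2 (.inr ⟨h₂, h₃, v, .inr ?_, .inl rfl⟩)
        by_contra hg
        exact h₁ ⟨h.1, hg⟩
      have h' : f v u ≠ 0 := by rw [hs]; exact h.1
      rcases hv with hv | hv | hv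
      · rw [if_pos hv]; omega
      · rw [if_pos (And.intro h.1 hv)]; omega
      · rw [if_pos (And.intro h' hv)]; omega
    · rw [if_neg h]; omega
  have hsum := sum_le_sum fun u (_ : u ∈ univ) => sum_le_sum fun v (_ : v ∈ univ) => key u v
  simp only [sum_add_distrib] at hsum
  have hlight : ∀ u, ∑ v, (if f u v ≠ 0 ∧ ¬ Heavy f u then 1 else 0) ≤ 10 * #(bad f u) := by
    intro u
    by_cases hu : Heavy f u
    · simp [hu]
    · simp only [hu, not_false_eq_true, and_true, ← card_filter]
      have : #{v | f u v ≠ 0} + 1 ≤ #(nbhd f u) := by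
        rw [← card_erase_add_one (mem_nbhd.2 (.inl rfl) : u ∈ nbhd f u)]
        gcongr
        intro v
        simp only [mem_filter, mem_univ, true_and, mem_erase, mem_nbhd]
        have := h0 u
        grind
      have hu' : ¬ 10 * #(bad f u) + 1 < #(nbhd f u) := hu
      omega
  have e₁ := sum_le_sum fun u (_ : u ∈ univ) => hlight u
  have e₂ : ∑ u, ∑ v, (if f v u ≠ 0 ∧ ¬ Heavy f v then 1 else 0) ≤ ∑ u, 10 * #(bad f u) := by
    rw [sum_comm]
    exact e₁
  have e₃ : ∑ u, ∑ v, (if v ∈ bad f u then 1 else 0) = ∑ u, #(bad f u) := by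
    refine sum_congr rfl fun u _ => ?_
    rw [← card_filter, filter_univ_mem]
  rw [← mul_sum] at e₁ e₂
  rw [e₃] at hsum
  simp only [card_filter]
  omega

/-- Dissolving a class costs no more than the `+` edges leaving it, up to a constant. -/
lemma card_not_same_le (u : V) : #{v | f u v ≠ 0 ∧ ¬ Same f u v} ≤
    121 * #{v | f u v ≠ 0 ∧ ¬ Linked f u v} := by
  have hout : ∀ v, #(nbhd f v \ cls f v) ≤ #{w | f v w ≠ 0 ∧ ¬ Linked f v w} := by
    intro v
    refine card_le_card fun w => ?_
    simp only [mem_sdiff, mem_nbhd, mem_cls, mem_filter, mem_univ, true_and]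
    have := Linked.refl (f := f) v
    grind
  by_cases hk : Kept f u
  · refine le_trans (card_le_card fun v => ?_) (Nat.le_mul_of_pos_left _ (by norm_num))
    simp only [mem_filter, mem_univ, true_and]
    simp only [Same]
    tauto
  · have h₁ : #{v | f u v ≠ 0 ∧ ¬ Same f u v} ≤
        #{v | f u v ≠ 0 ∧ ¬ Linked f u v} + #(cls f u) := by
      refine (card_le_card ?_).trans (card_union_le _ _)
      intro v
      simp only [mem_union, mem_filter, mem_univ, true_and, mem_cls]
      by_cases hl : Linked f u v <;> tauto
    -- The class is dissolved because of some `v`. The rows of `u` and `v` are so close that `u` too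
    -- has many neighbors outside, at least 1/120 of the size of the class; the remaining unit of
    -- 121 pays for the edges leaving it.
    have hk' : ∃ v, Linked f u v ∧ #(cls f v) < 60 * #(nbhd f v \ cls f v) := by
      simpa [Kept] using hk
    obtain ⟨v, hv, hlt⟩ := hk'
    have h₂ := hout u
    rcases eq_or_ne u v with rfl | hne
    · omega
    · have hcls := hv.cls_eq hs h0
      have d := hv.symm.rowDist_le hs h0
      obtain ⟨hu', hv', -⟩ := hv.resolve_left hne
      have h₃ := card_nbhd_sdiff_le (hv'.hue_ne_zero h0) (hu'.hue_ne_zero h0)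
      have h₄ : #(nbhd f v) ≤ #(nbhd f v \ cls f v) + #(cls f v) :=
        card_le_card_sdiff_add_card
      have h₅ : #(nbhd f v \ cls f v) ≤ #(nbhd f u \ cls f u) + #(nbhd f v \ nbhd f u) := by
        refine (card_le_card ?_).trans (card_union_le _ _)
        intro x
        rw [hcls]
        simp only [mem_union, mem_sdiff]
        tauto
      rw [hcls] at h₁ h₂ h₅
      omega

/-- The number of `+` edges between different preclusters, in terms of the disagreements of any
solution. -/
theorem sum_not_same_le {dis : V → V → Prop}
    (hd : ∀ u v w, f u v ≠ 0 → ¬ dis u v → w ∈ conflicts f u v → dis u w ∨ dis v w) :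
    ∑ u, #{v | f u v ≠ 0 ∧ ¬ Same f u v} ≤ 121 * (21 * (2001 * ∑ u, #{v | dis u v})) := by
  have h₁ := sum_le_sum fun u (_ : u ∈ univ) => card_not_same_le hs h0 u
  rw [← mul_sum] at h₁
  have h₂ := sum_not_linked_le hs h0
  have h₃ := sum_bad_le hs hd
  omega

/-! ### The number of admissible edges -/

/-- A common neighbor `w` of an admissible pair `u v` is in a different precluster from `u` or from
`v`, so `u w` or `v w` is a cut `+` edge. A cut edge `u w` gives `1 / #(nbhd f w)` to each `v` in
`nbhd f w`, in total 1. An admissible pair collects at least `1 / ((k + 2) c)` from each of at least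
`c / (k + 2)` common neighbors. The factor 2 comes from the two ends at which the cut may occur. -/
theorem sum_adm_le (k : ℕ) :
    ∑ u, #{v | Adm f k u v} ≤ 2 * (k + 2) ^ 2 * ∑ u, #{v | f u v ≠ 0 ∧ ¬ Same f u v} := by
  have hpos : ∀ u, (0 : ℝ) < #(nbhd f u) := fun u => by
    exact_mod_cast card_pos.2 ⟨u, mem_nbhd.2 (.inl rfl)⟩
  let cut : V → V → Prop := fun u v => f u v ≠ 0 ∧ ¬ Same f u v
  have key : ∀ u v, (if Adm f k u v then (1 : ℝ) else 0) ≤ (k + 2) ^ 2 *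
      ∑ w, ((if cut u w then (if v ∈ nbhd f w then (#(nbhd f w) : ℝ)⁻¹ else 0) else 0) +
      (if cut v w then (if u ∈ nbhd f w then (#(nbhd f w) : ℝ)⁻¹ else 0) else 0)) := by
    intro u v
    have hnn : ∀ w, (0 : ℝ) ≤
      ((if cut u w then (if v ∈ nbhd f w then (#(nbhd f w) : ℝ)⁻¹ else 0) else 0) +
      (if cut v w then (if u ∈ nbhd f w then (#(nbhd f w) : ℝ)⁻¹ else 0) else 0)) := fun w => by
      have := (inv_pos.2 (hpos w)).le
      split_ifs <;> linarith
    by_cases h : Adm f k u v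
    · rw [if_pos h]
      obtain ⟨hns, c, hc1, -, hc⟩ := h
      set C := common f k u v c with hC
      have hc0 : (0 : ℝ) < c := by exact_mod_cast hc1
      have hk0 : (0 : ℝ) < k + 2 := by positivity
      have h₁ : ∀ w ∈ C, ((k + 2 : ℝ) * c)⁻¹ ≤
          ((if cut u w then (if v ∈ nbhd f w then (#(nbhd f w) : ℝ)⁻¹ else 0) else 0) +
          (if cut v w then (if u ∈ nbhd f w then (#(nbhd f w) : ℝ)⁻¹ else 0) else 0)) := by
        intro w hw
        obtain ⟨hu, hv, hle⟩ := mem_common.1 hw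
        have hu' := (mem_nbhd_comm hs).1 hu
        have hv' := (mem_nbhd_comm hs).1 hv
        have hle' : ((k + 2 : ℝ) * c)⁻¹ ≤ (#(nbhd f w) : ℝ)⁻¹ := by
          refine inv_anti₀ (hpos w) ?_
          exact_mod_cast hle
        have hp := (inv_pos.2 (hpos w)).le
        have : cut u w ∨ cut v w := by
          by_contra! hcon
          have hsu : Same f u w := by
            by_contra hsu
            rcases mem_nbhd.1 hu with rfl | hu
            · exact hsu (Same.refl _)
            · exact hcon.1 ⟨hu, hsu⟩
          have hsv : Same f v w := by
            by_contra hsv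
            rcases mem_nbhd.1 hv with rfl | hv
            · exact hsv (Same.refl _)
            · exact hcon.2 ⟨hv, hsv⟩
          exact hns (hsu.trans hs h0 (hsv.symm hs h0))
        rcases this with h | h <;> simp only [h, hu', hv', if_true] <;> split_ifs <;> linarith
      have h₂ := (card_nsmul_le_sum C _ _ h₁).trans
        (sum_le_sum_of_subset_of_nonneg (subset_univ C) fun w _ _ => hnn w)
      rw [nsmul_eq_mul] at h₂
      have h₃ : (c : ℝ) ≤ (k + 2) * #C := by exact_mod_cast hc
      calc (1 : ℝ) ≤ (k + 2) ^ 2 * (#C * ((k + 2 : ℝ) * c)⁻¹) := by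
            field_simp
            linarith
        _ ≤ _ := by gcongr
    · rw [if_neg h]
      exact mul_nonneg (by positivity) (sum_nonneg fun w _ => hnn w)
  have hsum := sum_le_sum fun u (_ : u ∈ univ) => sum_le_sum fun v (_ : v ∈ univ) => key u v
  have e : ∑ u, ∑ v, ∑ w,
      (if cut u w then (if v ∈ nbhd f w then (#(nbhd f w) : ℝ)⁻¹ else 0) else 0) =
      ((∑ u, #{v | f u v ≠ 0 ∧ ¬ Same f u v} : ℕ) : ℝ) := by
    push_cast
    refine sum_congr rfl fun u _ => ?_
    rw [sum_comm]
    have : ∀ w, ∑ v, (if cut u w then (if v ∈ nbhd f w then (#(nbhd f w) : ℝ)⁻¹ else 0) else 0) =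
        if cut u w then 1 else 0 := by
      intro w
      split_ifs with h
      · rw [← sum_filter, filter_univ_mem, sum_const, nsmul_eq_mul, mul_inv_cancel₀ (hpos w).ne']
      · simp
    simp only [this, cut]
    simp
  have e' : ∑ u, ∑ v, ∑ w,
      (if cut v w then (if u ∈ nbhd f w then (#(nbhd f w) : ℝ)⁻¹ else 0) else 0) =
      ((∑ u, #{v | f u v ≠ 0 ∧ ¬ Same f u v} : ℕ) : ℝ) := by
    rw [sum_comm, ← e]
  simp only [← mul_sum, sum_add_distrib] at hsum
  rw [e, e'] at hsum
  have e₂ : ∑ u, ∑ v, (if Adm f k u v then (1 : ℝ) else 0) =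
      ((∑ u, #{v | Adm f k u v} : ℕ) : ℝ) := by
    push_cast
    refine sum_congr rfl fun u _ => ?_
    simp
  rw [e₂] at hsum
  have : ((∑ u, #{v | Adm f k u v} : ℕ) : ℝ) ≤
      2 * (k + 2) ^ 2 * ((∑ u, #{v | f u v ≠ 0 ∧ ¬ Same f u v} : ℕ) : ℝ) := by linarith
  exact_mod_cast this

/-! ### Preclusters are dense and monochromatic -/

/-- Count the `+` edges between `Z` and the set `T` of near vertices twice. A vertex of `Z` has
almost the row of `v`, so it is adjacent to nearly all of `T`; a vertex of `T` has almost the row of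
`v` too, so it has very few neighbors outside `nbhd f v`. As `T` has at least 9/10 of the size of
`nbhd f v`, `Z` must be small. -/
lemma card_cls_sdiff_nbhd_le {v : V} (hv : Heavy f v) :
    397 * #(cls f v \ nbhd f v) ≤ #(nbhd f v) := by
  set Z := cls f v \ nbhd f v
  set T : Finset V := {w | Near f v w} with hT
  have hv₀ := hv.hue_ne_zero h0
  have hpos : 0 < #(nbhd f v) := card_pos.2 ⟨v, mem_nbhd.2 (.inl rfl)⟩
  have h₁ : ∀ x ∈ Z, 200 * #T ≤ 200 * #(T.bipartiteAbove (fun x w => f x w ≠ 0) x) +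
      #(nbhd f v) := by
    intro x hx
    rw [mem_sdiff, mem_cls] at hx
    have hx₀ : hue f x ≠ 0 := by rwa [← hx.1.hue_eq hs h0]
    have hd := hx.1.rowDist_le hs h0
    have : #T ≤ #(T.bipartiteAbove (fun x w => f x w ≠ 0) x) + rowDist f v x := by
      refine (card_le_card ?_).trans (card_union_le _ _)
      intro w hw
      have hwn : w ∈ nbhd f v := by
        simp only [hT, mem_filter, mem_univ, true_and] at hw
        exact hw.mem_nbhd
      have hwv := (mem_nbhd_iff_row hv₀).1 hwn
      have hwx := mem_nbhd_iff_row (w := w) hx₀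
      simp only [mem_union, mem_bipartiteAbove, mem_filter, mem_univ, true_and, hw]
      rw [mem_nbhd] at hwx
      grind
    omega
  have h₂ : ∀ w ∈ T, 400 * #(Z.bipartiteBelow (fun x w => f x w ≠ 0) w) ≤ #(nbhd f v) := by
    intro w hw
    simp only [hT, mem_filter, mem_univ, true_and] at hw
    have hw₀ : hue f w ≠ 0 := by rwa [hw.hue_eq hs h0]
    have hd := hw.rowDist_le hs h0
    have hle := card_nbhd_le hw₀ hv₀
    have hc := rowDist_comm (f := f) v w
    have hsd := card_nbhd_sdiff_le hw₀ hv₀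
    have : #(Z.bipartiteBelow (fun x w => f x w ≠ 0) w) ≤ #(nbhd f w \ nbhd f v) := by
      refine card_le_card fun x => ?_
      simp only [mem_bipartiteBelow, Z, mem_sdiff, mem_nbhd, hs x w]
      tauto
    omega
  have e := sum_card_bipartiteAbove_eq_sum_card_bipartiteBelow (s := Z) (t := T)
    (fun x w => f x w ≠ 0)
  have s₁ := sum_le_sum h₁
  have s₂ := sum_le_sum h₂
  simp only [sum_add_distrib, ← mul_sum, sum_const, smul_eq_mul] at s₁ s₂
  rw [e] at s₁
  have h₃ : 9 * #(nbhd f v) ≤ 10 * #T := by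
    have := card_nbhd_le_near (f := f) v
    rw [← hT] at this
    have hv' : 10 * #(bad f v) + 1 < #(nbhd f v) := hv
    omega
  have hTpos : 0 < #T := by omega
  have h₄ : #Z * (9 * #(nbhd f v)) ≤ #Z * (10 * #T) := Nat.mul_le_mul_left _ h₃
  have h₅ : (397 * #Z) * #T ≤ #(nbhd f v) * #T := by nlinarith
  exact Nat.le_of_mul_le_mul_right h₅ hTpos

omit hs h0 in
lemma Good.card_miscolored_le {v y : V} (h : Good f v y) :
    400 * #{x | f v x ≠ 0 ∧ x ≠ v ∧ f v x ≠ f v y} ≤ #(nbhd f v) := by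
  have h₁ : #{x | f v x ≠ 0 ∧ x ≠ v ∧ f v x ≠ f v y} ≤ #(conflicts f v y) := by
    refine card_le_card fun x => ?_
    simp only [mem_filter, mem_univ, true_and, mem_conflicts]
    grind
  have h₂ := h.2
  have h₃ := card_nbhd_le_add_conflicts h.1
  omega

omit hs h0 in
lemma Linked.heavy_of_ne {u v : V} (h : Linked f u v) (hne : u ≠ v) : Heavy f u ∧ Heavy f v :=
  let h := h.resolve_left hne
  ⟨h.1, h.2.1⟩

omit hs h0 in
lemma Kept.card_out_le {v : V} (hk : Kept f v) :
    60 * #{x | x ∉ cls f v ∧ f v x ≠ 0} ≤ #(cls f v) := by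
  have h₁ : #{x | x ∉ cls f v ∧ f v x ≠ 0} ≤ #(nbhd f v \ cls f v) := by
    refine card_le_card fun x => ?_
    simp only [mem_filter, mem_univ, true_and, mem_sdiff, mem_nbhd]
    tauto
  have := hk v (Linked.refl v)
  omega

/-- An exceptional vertex is either a neighbor along a wrongly colored edge, hence a conflict of a
good edge, or a non-neighbor in the class. Both kinds are few, and `nbhd f v` is hardly larger than
a kept class. -/
lemma Kept.card_off_color_le {v : V} (hk : Kept f v) (hv : Heavy f v) :
    50 * #{x ∈ cls f v | x ≠ v ∧ f v x ≠ hue f v} ≤ #(cls f v) := by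
  obtain ⟨y, hy⟩ := hv.exists_good
  have h₁ := hy.card_miscolored_le
  have h₂ := card_cls_sdiff_nbhd_le hs h0 hv
  have h₃ : #(nbhd f v) ≤ #(nbhd f v \ cls f v) + #(cls f v) := card_le_card_sdiff_add_card
  have h₄ := hk v (Linked.refl v)
  have h₅ : #{x ∈ cls f v | x ≠ v ∧ f v x ≠ hue f v} ≤
      #{x | f v x ≠ 0 ∧ x ≠ v ∧ f v x ≠ f v y} + #(cls f v \ nbhd f v) := by
    refine (card_le_card ?_).trans (card_union_le _ _)
    intro x
    have := hy.eq_hue h0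
    simp only [mem_union, mem_filter, mem_univ, true_and, mem_sdiff, mem_nbhd]
    grind
  omega

end Preclusters

/-! ## Minimizers of a perturbed cost -/

section Labelings

variable {m : ℕ}

/-- The pair of labels `a b` agrees with an edge of code `e`. The labels `some (i, c)` stand for
the cluster number `i` of color `c`, and vertices labeled `none` are singleton clusters. -/
def Agrees (e : ℕ) (a b : Option (ℕ × Fin m)) : Prop :=
  if e = 0 then ¬ (a = b ∧ a ≠ none) else ∃ i, ∃ c : Fin m, a = some (i, c) ∧ b = a ∧ e = c + 1

/-- The perturbed cost of an edge: `-` edges inside clusters cost a little more, and so do `+`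
edges between clusters, for each endpoint not labeled `none`. -/
noncomputable def weight (k e : ℕ) (a b : Option (ℕ × Fin m)) : ℕ :=
  if Agrees e a b then 0
  else if e = 0 then k + 3
  else if a = b ∧ a ≠ none then k
  else k + (if a = none then 0 else 1) + (if b = none then 0 else 1)

/-! ### Bounds for the perturbed weight -/

lemma agrees_comm {e : ℕ} {a b : Option (ℕ × Fin m)} : Agrees e a b ↔ Agrees e b a := by
  unfold Agrees
  split_ifs <;> grind

lemma weight_comm (k e : ℕ) (a b : Option (ℕ × Fin m)) : weight k e a b = weight k e b a := by
  have := agrees_comm (e := e) (a := a) (b := b)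
  unfold weight
  grind

lemma weight_of_agrees {k e : ℕ} {a b : Option (ℕ × Fin m)} (h : Agrees e a b) :
    weight k e a b = 0 := if_pos h

lemma le_weight {k e : ℕ} {a b : Option (ℕ × Fin m)} (h : ¬ Agrees e a b) :
    k ≤ weight k e a b := by
  unfold weight
  grind

lemma weight_le (k e : ℕ) (a b : Option (ℕ × Fin m)) : weight k e a b ≤ k + 3 := by
  unfold weight
  grind

variable {V : Type} [Fintype V] (k : ℕ) (f : V → V → ℕ) (g : V → Option (ℕ × Fin m))

/-- The perturbed cost of a pair of vertices. -/
noncomputable def pairWeight (u v : V) : ℕ := if u = v then 0 else weight k (f u v) (g u) (g v)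

/-- The perturbed cost of a labeling, counting every edge twice. -/
noncomputable def potential : ℕ := ∑ u, ∑ v, pairWeight k f g u v

/-- The labeling `g` minimizes the perturbed cost. -/
def IsOptimal : Prop := ∀ g' : V → Option (ℕ × Fin m), potential k f g ≤ potential k f g'

/-- There are infinitely many labels, so that unused cluster numbers are always available; a minimum
exists nevertheless because the potential is a natural number. -/
lemma exists_isOptimal : ∃ g : V → Option (ℕ × Fin m), IsOptimal k f g :=
  ⟨Function.argmin (potential k f), fun g' => Function.argmin_le (potential k f) g'⟩

variable {k f g}

lemma sum_sum_split {F : V → V → ℕ} (hF : ∀ u v, F u v = F v u) (X : Finset V) :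
    ∑ u, ∑ v, F u v =
      ∑ u ∈ X, (∑ v ∈ X, F u v + 2 * ∑ v ∈ Xᶜ, F u v) + ∑ u ∈ Xᶜ, ∑ v ∈ Xᶜ, F u v := by
  have h₁ : ∀ u, ∑ v, F u v = ∑ v ∈ X, F u v + ∑ v ∈ Xᶜ, F u v := fun u =>
    (sum_add_sum_compl X _).symm
  have h₂ : ∑ u ∈ Xᶜ, ∑ v ∈ X, F u v = ∑ u ∈ X, ∑ v ∈ Xᶜ, F u v := by
    rw [sum_comm]
    exact sum_congr rfl fun u _ => sum_congr rfl fun v _ => hF v u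
  rw [← sum_add_sum_compl X]
  simp only [h₁, sum_add_distrib, h₂, ← mul_sum]
  ring

variable (hs : ∀ u v, f u v = f v u)
include hs

omit [Fintype V] in
lemma pairWeight_comm (u v : V) : pairWeight k f g u v = pairWeight k f g v u := by
  unfold pairWeight
  rw [hs u v, weight_comm]
  simp only [eq_comm]

/-- An optimal labeling cannot be improved by relabeling the vertices of `X`. -/
lemma IsOptimal.le_of_eqOn (hg : IsOptimal k f g) (X : Finset V) (g' : V → Option (ℕ × Fin m))
    (h : ∀ v, v ∉ X → g' v = g v) :
    ∑ u ∈ X, (∑ v ∈ X, pairWeight k f g u v + 2 * ∑ v ∈ Xᶜ, pairWeight k f g u v) ≤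
    ∑ u ∈ X, (∑ v ∈ X, pairWeight k f g' u v + 2 * ∑ v ∈ Xᶜ, pairWeight k f g' u v) := by
  have h₁ := hg g'
  unfold potential at h₁
  rw [sum_sum_split (pairWeight_comm hs) X, sum_sum_split (pairWeight_comm hs) X] at h₁
  have h₂ : ∑ u ∈ Xᶜ, ∑ v ∈ Xᶜ, pairWeight k f g' u v =
      ∑ u ∈ Xᶜ, ∑ v ∈ Xᶜ, pairWeight k f g u v := by
    refine sum_congr rfl fun u hu => sum_congr rfl fun v hv => ?_
    rw [mem_compl] at hu hv
    simp only [pairWeight, h u hu, h v hv]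
  omega

/-- An optimal labeling cannot be improved by relabeling the vertex `v`. -/
lemma IsOptimal.le_single (hg : IsOptimal k f g) (v : V) (a : Option (ℕ × Fin m)) :
    ∑ u ∈ {v}ᶜ, weight k (f v u) (g v) (g u) ≤ ∑ u ∈ {v}ᶜ, weight k (f v u) a (g u) := by
  have h := hg.le_of_eqOn hs {v} (Function.update g v a) (by
    intro w hw
    rw [mem_singleton] at hw
    rw [Function.update_of_ne hw])
  simp only [sum_singleton] at h
  have e₁ : ∑ u ∈ {v}ᶜ, pairWeight k f g v u = ∑ u ∈ {v}ᶜ, weight k (f v u) (g v) (g u) := by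
    refine sum_congr rfl fun u hu => ?_
    rw [mem_compl, mem_singleton] at hu
    rw [pairWeight, if_neg (Ne.symm hu)]
  have e₂ : ∑ u ∈ {v}ᶜ, pairWeight k f (Function.update g v a) v u =
      ∑ u ∈ {v}ᶜ, weight k (f v u) a (g u) := by
    refine sum_congr rfl fun u hu => ?_
    rw [mem_compl, mem_singleton] at hu
    rw [pairWeight, if_neg (Ne.symm hu), Function.update_self, Function.update_of_ne hu]
  rw [e₁, e₂] at h
  simp only [pairWeight, if_true] at h
  omega

/-- Isolating a vertex does not improve an optimal labeling. -/
lemma IsOptimal.isolate (hg : IsOptimal k f g) {v : V} (hv : g v ≠ none) :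
    (k + 3) * #{u ∈ {v}ᶜ | g u = g v ∧ f v u = 0} + #{u ∈ {v}ᶜ | g u ≠ g v ∧ f v u ≠ 0} ≤
    (k + 1) * #{u ∈ {v}ᶜ | g u = g v ∧ f v u ≠ 0} := by
  have h := hg.le_single hs v none
  -- Isolating `v` saves `k + 3` on each `-` edge inside its cluster and 1 on each `+` edge leaving
  -- it, since `v` loses its label; it costs at most `k + 1` on each `+` edge inside.
  have key : ∀ u ∈ ({v}ᶜ : Finset V), weight k (f v u) none (g u) +
      (k + 3) * (if g u = g v ∧ f v u = 0 then 1 else 0) +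
      (if g u ≠ g v ∧ f v u ≠ 0 then 1 else 0) ≤ weight k (f v u) (g v) (g u) +
      (k + 1) * (if g u = g v ∧ f v u ≠ 0 then 1 else 0) := by
    intro u _
    by_cases hf : f v u = 0
    · by_cases hu : g u = g v <;> simp [weight, Agrees, hf, hu, hv, eq_comm]
    · by_cases hu : g u = g v
      · simp [weight, Agrees, hf, hu, hv]
      · have hu' : g v ≠ g u := Ne.symm hu
        have hn : ¬ Agrees (f v u) (g v) (g u) := by
          rw [Agrees, if_neg hf]
          rintro ⟨i, c, -, h, -⟩
          exact hu h
        simp only [weight, hn, if_false, hf, hu, hu', hv, false_and]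
        simp [Agrees, hf, hu]
  have hsum := sum_le_sum key
  simp only [sum_add_distrib, ← mul_sum, ← card_filter] at hsum
  omega

/-- Distinct vertices in a common cluster of an optimal labeling are joined by an admissible edge
or lie in the same precluster. -/
theorem IsOptimal.same_or_adm (hg : IsOptimal k f g) (h0 : ∀ u, f u u = 0) {u v : V}
    (hu : g u ≠ none) (huv : g u = g v) : Same f u v ∨ Adm f k u v := by
  by_cases hS : Same f u v
  · exact .inl hS
  -- The scale `c` is the size of the common cluster.
  refine .inr ⟨hS, #{w | g w = g u}, card_pos.2 ⟨u, by simp⟩, card_le_univ _, ?_⟩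
  -- The closed neighborhood of `v` contains at least the fraction `(k + 3) / (2k + 4)` of its
  -- cluster, which is `1 / (2k + 4)` more than half. Two such sets overlap in at least the fraction
  -- `1 / (k + 2)`.
  have facts : ∀ v, g v = g u → #(nbhd f v) ≤ (k + 2) * #{w | g w = g u} ∧
      (k + 3) * #{w | g w = g u} ≤ (2 * k + 4) * #{w ∈ nbhd f v | g w = g u} := by
    intro v hv
    have hiso := hg.isolate hs (v := v) (by rwa [hv])
    rw [hv] at hiso
    have c₁ : #{w | g w = g u} = #{w ∈ {v}ᶜ | g w = g u ∧ f v w = 0} +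
        #{w ∈ {v}ᶜ | g w = g u ∧ f v w ≠ 0} + 1 := by
      rw [← card_union_of_disjoint, ← card_insert_of_notMem (a := v)]
      · congr 1
        ext w
        simp only [mem_filter, mem_univ, true_and, mem_insert, mem_union, mem_compl,
          mem_singleton]
        grind
      · simp
      · rw [disjoint_filter]
        grind
    have c₂ : #{w ∈ nbhd f v | g w = g u} = #{w ∈ {v}ᶜ | g w = g u ∧ f v w ≠ 0} + 1 := by
      rw [← card_insert_of_notMem (a := v)]
      · congr 1
        ext w
        have := h0 v
        simp only [mem_filter, mem_nbhd, mem_insert, mem_compl, mem_singleton]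
        grind
      · simp
    have c₃ : #(nbhd f v) = #{w ∈ nbhd f v | g w = g u} +
        #{w ∈ {v}ᶜ | g w ≠ g u ∧ f v w ≠ 0} := by
      rw [← card_union_of_disjoint]
      · congr 1
        ext w
        simp only [mem_filter, mem_nbhd, mem_union, mem_compl, mem_singleton]
        grind
      · rw [disjoint_left]
        simp only [mem_filter]
        grind
    rw [c₃, c₂, c₁]
    constructor <;> nlinarith
  obtain ⟨-, hu₂⟩ := facts u rfl
  obtain ⟨-, hv₂⟩ := facts v huv.symm
  have hov : #{w ∈ nbhd f u | g w = g u} + #{w ∈ nbhd f v | g w = g u} ≤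
      #{w | g w = g u} + #(common f k u v #{w | g w = g u}) := by
    rw [← card_union_add_card_inter]
    refine Nat.add_le_add (card_le_card fun w => ?_) (card_le_card fun w => ?_)
    · simp only [mem_union, mem_filter, mem_univ, true_and]
      tauto
    · have := facts w
      simp only [mem_inter, mem_filter, mem_common]
      tauto
  nlinarith

/-- A dense monochromatic set with few `+` edges leaving it lies in one cluster of an optimal
labeling, and the cluster has the right color. -/
theorem IsOptimal.exists_label (hg : IsOptimal k f g) (hk : 3 ≤ k) {K : Finset V} (c : Fin m)
    (hK : 2 ≤ #K) (hin : ∀ v ∈ K, 50 * #{x ∈ K | x ≠ v ∧ f v x ≠ c + 1} ≤ #K)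
    (hout : ∀ v ∈ K, 50 * #{x | x ∉ K ∧ f v x ≠ 0} ≤ #K) :
    ∃ i, ∀ v ∈ K, g v = some (i, c) := by
  obtain ⟨i₀, hi₀⟩ := Infinite.exists_notMem_finset
    (univ.image fun u => ((g u).map Prod.fst).getD 0)
  have hfresh : ∀ u c', g u ≠ some (i₀, c') := by
    intro u c' h
    exact hi₀ (mem_image.2 ⟨u, mem_univ u, by simp [h]⟩)
  have hmove := hg.le_of_eqOn hs K (fun v => if v ∈ K then some (i₀, c) else g v)
    (fun v hv => if_neg hv)
  set g' : V → Option (ℕ × Fin m) := fun v => if v ∈ K then some (i₀, c) else g v with hg'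
  -- Moving all of `K` to a fresh cluster of color `c` does not help, so on average some `v₀` is
  -- served by `g` at least as well. As the new labeling is cheap at `v₀`, so is `g`.
  obtain ⟨v₀, hv₀, hle⟩ := exists_le_of_sum_le (card_pos.1 (by omega)) hmove
  have a₁ : ∑ x ∈ K, pairWeight k f g' v₀ x ≤ (k + 3) * #{x ∈ K | x ≠ v₀ ∧ f v₀ x ≠ c + 1} := by
    rw [card_filter, mul_sum]
    refine sum_le_sum fun x hx => ?_
    unfold pairWeight
    by_cases hxv : v₀ = x
    · simp [hxv]
    · by_cases hf : f v₀ x = c + 1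
      · rw [if_neg hxv, weight_of_agrees]
        · simp
        · simp [Agrees, hg', hv₀, hx, hf]
      · rw [if_neg hxv, if_pos (And.intro (Ne.symm hxv) hf), mul_one]
        exact weight_le ..
  have a₂ : ∑ x ∈ Kᶜ, pairWeight k f g' v₀ x ≤ (k + 2) * #{x | x ∉ K ∧ f v₀ x ≠ 0} := by
    have : ({x | x ∉ K ∧ f v₀ x ≠ 0} : Finset V) = {x ∈ Kᶜ | f v₀ x ≠ 0} := by
      ext x; simp
    rw [this, card_filter, mul_sum]
    refine sum_le_sum fun x hx => ?_
    rw [mem_compl] at hx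
    have hne : some (i₀, c) ≠ g x := (hfresh x c).symm
    have hxv : v₀ ≠ x := fun h => hx (h ▸ hv₀)
    simp only [pairWeight, hxv, if_false, hg', hv₀, hx, if_true]
    by_cases hf : f v₀ x = 0
    · rw [weight_of_agrees]
      · simp
      · simp [Agrees, hf, hne]
    · have hn : ¬ Agrees (f v₀ x) (some (i₀, c)) (g x) := by
        rw [Agrees, if_neg hf]
        rintro ⟨i, c, -, h, -⟩
        exact hne h.symm
      simp only [weight, hn, if_false, hf, hne, false_and]
      grind
  have a₃ : k * #{x ∈ K | x ≠ v₀ ∧ ¬ ∃ i, g v₀ = some (i, c) ∧ g x = some (i, c)} ≤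
      ∑ x ∈ K, pairWeight k f g v₀ x + k * #{x ∈ K | x ≠ v₀ ∧ f v₀ x ≠ c + 1} := by
    rw [card_filter, card_filter, mul_sum, mul_sum, ← sum_add_distrib]
    refine sum_le_sum fun x hx => ?_
    split_ifs with h₁ h₂
    · omega
    · have hf : f v₀ x = c + 1 := by tauto
      have : ¬ Agrees (f v₀ x) (g v₀) (g x) := by
        rw [Agrees, hf, if_neg (by omega)]
        rintro ⟨i, c', h₃, h₄, h₅⟩
        refine h₁.2 ⟨i, ?_⟩
        have : c' = c := by ext; omega
        rw [h₄, h₃, this]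
        exact ⟨rfl, rfl⟩
      have := le_weight (k := k) this
      rw [pairWeight, if_neg (Ne.symm h₁.1)]
      omega
    · omega
    · omega
  have a₄ : k * #{x | x ∉ K ∧ g x = g v₀ ∧ g v₀ ≠ none} ≤
      ∑ x ∈ Kᶜ, pairWeight k f g v₀ x + k * #{x | x ∉ K ∧ f v₀ x ≠ 0} := by
    have e₁ : ({x | x ∉ K ∧ f v₀ x ≠ 0} : Finset V) = {x ∈ Kᶜ | f v₀ x ≠ 0} := by
      ext x; simp
    have e₂ : ({x | x ∉ K ∧ g x = g v₀ ∧ g v₀ ≠ none} : Finset V) =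
        {x ∈ Kᶜ | g x = g v₀ ∧ g v₀ ≠ none} := by
      ext x; simp
    rw [e₁, e₂, card_filter, card_filter, mul_sum, mul_sum, ← sum_add_distrib]
    refine sum_le_sum fun x hx => ?_
    rw [mem_compl] at hx
    have hxv : v₀ ≠ x := fun h => hx (h ▸ hv₀)
    split_ifs with h₁ h₂
    · omega
    · have : ¬ Agrees (f v₀ x) (g v₀) (g x) := by
        rw [Agrees, if_pos (not_not.1 h₂), not_not]
        exact ⟨h₁.1.symm, h₁.2⟩
      have := le_weight (k := k) this
      rw [pairWeight, if_neg hxv]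
      omega
    · omega
    · omega
  have b₁ := hin v₀ hv₀
  have b₂ := hout v₀ hv₀
  set q := #{x ∈ K | x ≠ v₀ ∧ ¬ ∃ i, g v₀ = some (i, c) ∧ g x = some (i, c)} with hq
  set y := #{x | x ∉ K ∧ g x = g v₀ ∧ g v₀ ≠ none} with hy
  -- Here `q` counts the vertices of `K` that do not share a cluster of color `c` with `v₀`, and `y`
  -- the vertices outside `K` in the cluster of `v₀`. The four estimates give `50 k (q + 2y) ≤ (6k +
  -- 7) #K`, and `7 ≤ 3k`.
  have hqy : 50 * q + 100 * y ≤ 9 * #K := by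
    refine Nat.le_of_mul_le_mul_left (c := k) ?_ (by omega)
    nlinarith
  obtain ⟨x₀, hx₀, hne₀, i, hi, -⟩ :
      ∃ x ∈ K, x ≠ v₀ ∧ ∃ i, g v₀ = some (i, c) ∧ g x = some (i, c) := by
    by_contra! hcon
    have : #(K.erase v₀) ≤ q := by
      refine card_le_card fun x hx => ?_
      rw [mem_erase] at hx
      simp only [mem_filter]
      refine ⟨hx.2, hx.1, ?_⟩
      rintro ⟨i, h₁, h₂⟩
      exact hcon x hx.2 hx.1 i h₁ h₂
    rw [card_erase_of_mem hv₀] at this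
    omega
  refine ⟨i, fun v hv => ?_⟩
  -- The cluster of `v₀` is now `K` up to small errors. A vertex `v` of `K` elsewhere disagrees with
  -- at least 4/5 of `K`, but would have at most 22/100 of `#K` disagreements inside that cluster;
  -- since `k + 3 ≤ 2k`, moving it there would pay off.
  by_contra hvi
  have hq' : #{x ∈ K | g x ≠ some (i, c)} ≤ q := by
    refine card_le_card fun x => ?_
    simp only [mem_filter]
    rintro ⟨hx, hxi⟩
    refine ⟨hx, ?_, ?_⟩
    · rintro rfl
      exact hxi hi
    · rintro ⟨j, h₁, h₂⟩
      rw [hi] at h₁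
      rw [h₂, ← h₁] at hxi
      exact hxi rfl
  have hy' : #{x | x ∉ K ∧ g x = some (i, c)} = y := by
    simp [hy, hi]
  have hm := hg.le_single hs v (some (i, c))
  have hnew : ∑ u ∈ {v}ᶜ, weight k (f v u) (some (i, c)) (g u) ≤ (k + 3) *
      (#{x ∈ K | x ≠ v ∧ f v x ≠ c + 1} + #{x ∈ K | g x ≠ some (i, c)} +
        #{x | x ∉ K ∧ g x = some (i, c)} + #{x | x ∉ K ∧ f v x ≠ 0}) := by
    have hcount : #{u ∈ {v}ᶜ | ¬ Agrees (f v u) (some (i, c)) (g u)} ≤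
        #{x ∈ K | x ≠ v ∧ f v x ≠ c + 1} + #{x ∈ K | g x ≠ some (i, c)} +
        #{x | x ∉ K ∧ g x = some (i, c)} + #{x | x ∉ K ∧ f v x ≠ 0} := by
      refine le_trans (card_le_card fun x => ?_) ((card_union_le
        (({x ∈ K | x ≠ v ∧ f v x ≠ c + 1} ∪ {x ∈ K | g x ≠ some (i, c)}) ∪
        ({x | x ∉ K ∧ g x = some (i, c)} : Finset V)) {x | x ∉ K ∧ f v x ≠ 0}).trans
        (Nat.add_le_add_right ((card_union_le _ _).trans
        (Nat.add_le_add_right (card_union_le _ _) _)) _))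
      simp only [mem_filter, mem_union, mem_compl, mem_singleton, mem_univ, true_and]
      rintro ⟨hxv, hx⟩
      unfold Agrees at hx
      split_ifs at hx with hf
      · by_cases hxK : x ∈ K
        · left; left; left
          exact ⟨hxK, hxv, by omega⟩
        · left; right
          refine ⟨hxK, ?_⟩
          rw [not_not] at hx
          exact hx.1.symm
      · by_cases hxK : x ∈ K
        · left; left
          by_cases hgx : g x = some (i, c)
          · left
            refine ⟨hxK, hxv, fun hfc => hx ⟨i, c, rfl, hgx, hfc⟩⟩
          · right
            exact ⟨hxK, hgx⟩
        · right
          exact ⟨hxK, hf⟩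
    refine le_trans ?_ (Nat.mul_le_mul_left _ hcount)
    rw [card_filter, mul_sum]
    refine sum_le_sum fun x _ => ?_
    split_ifs with h
    · rw [weight_of_agrees h]
      exact Nat.zero_le _
    · rw [mul_one]
      exact weight_le ..
  have hold : k * #{x ∈ {v}ᶜ | x ∈ K ∧ g x = some (i, c) ∧ f v x = c + 1} ≤
      ∑ u ∈ {v}ᶜ, weight k (f v u) (g v) (g u) := by
    rw [card_filter, mul_sum]
    refine sum_le_sum fun x _ => ?_
    split_ifs with h
    · rw [mul_one]
      refine le_weight ?_
      rw [Agrees, if_neg (by omega)]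
      rintro ⟨j, c', h₁, h₂, -⟩
      exact hvi (h₂ ▸ h.2.1)
    · simp
  have hcov : #K ≤ #{x ∈ {v}ᶜ | x ∈ K ∧ g x = some (i, c) ∧ f v x = c + 1} +
      #{x ∈ K | g x ≠ some (i, c)} + #{x ∈ K | x ≠ v ∧ f v x ≠ c + 1} := by
    refine (card_le_card fun x hx => ?_).trans ((card_union_le
      (({x ∈ ({v}ᶜ : Finset V) | x ∈ K ∧ g x = some (i, c) ∧ f v x = c + 1} : Finset V) ∪
        {x ∈ K | g x ≠ some (i, c)})
      {x ∈ K | x ≠ v ∧ f v x ≠ c + 1}).trans (Nat.add_le_add_right (card_union_le _ _) _))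
    simp only [mem_filter, mem_union, mem_compl, mem_singleton]
    grind
  have c₁ := hin v hv
  have c₂ := hout v hv
  set G := #{x ∈ {v}ᶜ | x ∈ K ∧ g x = some (i, c) ∧ f v x = c + 1}
  have hG : 100 * G ≤ 44 * #K := by
    refine Nat.le_of_mul_le_mul_left (c := k) ?_ (by omega)
    have t₁ := hold.trans (hm.trans hnew)
    set T := #{x ∈ K | x ≠ v ∧ f v x ≠ c + 1} + #{x ∈ K | g x ≠ some (i, c)} +
        #{x | x ∉ K ∧ g x = some (i, c)} + #{x | x ∉ K ∧ f v x ≠ 0} with hT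
    have t₂ : 100 * T ≤ 22 * #K := by omega
    have t₃ : (k + 3) * T ≤ 2 * k * T := Nat.mul_le_mul_right _ (by omega)
    nlinarith
  omega

end Labelings


/-! ## Solutions and labelings -/

variable {n m : ℕ}

section Codes

variable (I : Instance (Fin n) (Fin m))

lemma edgeCode_of_adj {u v : Fin n} (h : s(u, v) ∈ I.pos.edgeSet) :
    edgeCode I u v = I.color ⟨s(u, v), h⟩ + 1 := by
  rw [edgeCode, dif_pos h, add_comm]

lemma edgeCode_eq_zero {u v : Fin n} : edgeCode I u v = 0 ↔ ¬ I.pos.Adj u v := by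
  rw [edgeCode, ← SimpleGraph.mem_edgeSet]
  split_ifs with h <;> simp [h]

lemma edgeCode_comm (u v : Fin n) : edgeCode I u v = edgeCode I v u := by
  by_cases h : I.pos.Adj u v
  · rw [edgeCode_of_adj I h, edgeCode_of_adj I h.symm]
    congr 3
    exact Subtype.ext Sym2.eq_swap
  · rw [(edgeCode_eq_zero I).2 h, (edgeCode_eq_zero I).2 fun h' => h h'.symm]

lemma edgeCode_self (u : Fin n) : edgeCode I u u = 0 :=
  (edgeCode_eq_zero I).2 (I.pos.loopless.irrefl u)

lemma edgeCode_le (u v : Fin n) : edgeCode I u v ≤ m := by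
  by_cases h : I.pos.Adj u v
  · rw [edgeCode_of_adj I h]
    omega
  · rw [(edgeCode_eq_zero I).2 h]
    omega

end Codes

/-- Twice the number of edges of a graph as a sum over ordered pairs. -/
lemma sum_card_adj {V : Type} [Fintype V] (G : SimpleGraph V) :
    ∑ u, #{v | G.Adj u v} = 2 * #G.edgeFinset := by
  rw [← SimpleGraph.sum_degrees_eq_twice_card_edges]
  refine sum_congr rfl fun u _ => ?_
  rw [← SimpleGraph.card_neighborFinset_eq_degree]
  congr 1
  ext v
  simp

/-- The labeling `g` describes the solution `S`. -/
structure Describes (g : Fin n → Option (ℕ × Fin m)) (S : Solution (Fin n) (Fin m)) : Prop where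
  same : ∀ u v, u ≠ v →
    ((∃ C ∈ S.clusters.parts, u ∈ C ∧ v ∈ C) ↔ g u = g v ∧ g u ≠ none)
  color : ∀ (C : {C : Finset (Fin n) // C ∈ S.clusters.parts}) (u v : Fin n), u ≠ v →
    u ∈ (C : Finset (Fin n)) → v ∈ (C : Finset (Fin n)) → ∃ i, g u = some (i, S.color C)

/-- The edges disagreeing with a labeling. -/
def disagreementGraph (I : Instance (Fin n) (Fin m)) (g : Fin n → Option (ℕ × Fin m)) :
    SimpleGraph (Fin n) where
  Adj u v := u ≠ v ∧ ¬ Agrees (edgeCode I u v) (g u) (g v)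
  symm := ⟨fun u v h => ⟨h.1.symm, by rw [edgeCode_comm, agrees_comm]; exact h.2⟩⟩
  loopless := ⟨fun _ h => h.1 rfl⟩

/-! ### Costs of solutions in terms of labelings -/

section Describes

variable {I : Instance (Fin n) (Fin m)} {g : Fin n → Option (ℕ × Fin m)}
  {S : Solution (Fin n) (Fin m)}

lemma Describes.disagrees_iff (h : Describes g S) {u v : Fin n} (hne : u ≠ v) :
    Disagrees I S u v ↔ ¬ Agrees (edgeCode I u v) (g u) (g v) := by
  unfold Disagrees Agrees
  by_cases hadj : I.pos.Adj u v
  · have hcode := edgeCode_of_adj I hadj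
    have h0 : edgeCode I u v ≠ 0 := by omega
    rw [if_neg h0, h.same u v hne]
    constructor
    · rintro (⟨h₁, -⟩ | ⟨-, h₁⟩ | ⟨e, C, he, hu, hv, hc⟩)
      · exact absurd hadj h₁
      · rintro ⟨i, c, h₂, h₃, -⟩
        exact h₁ ⟨h₃.symm, by simp [h₂]⟩
      · rintro ⟨i, c, h₂, -, h₄⟩
        obtain ⟨j, hj⟩ := h.color C u v hne hu hv
        rw [h₂, Option.some_inj, Prod.mk.injEq] at hj
        refine hc ?_
        have he' : e = ⟨s(u, v), hadj⟩ := Subtype.ext he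
        rw [he', ← hj.2]
        ext
        omega
    · intro hn
      by_cases hsame : g u = g v ∧ g u ≠ none
      · obtain ⟨C, hC, hu, hv⟩ := (h.same u v hne).2 hsame
        obtain ⟨i, hi⟩ := h.color ⟨C, hC⟩ u v hne hu hv
        refine .inr (.inr ⟨⟨s(u, v), hadj⟩, ⟨C, hC⟩, rfl, hu, hv, fun hc => hn ?_⟩)
        exact ⟨i, _, hi, hsame.1.symm, by rw [hcode, hc]⟩
      · exact .inr (.inl ⟨hadj, hsame⟩)
  · have hcode := (edgeCode_eq_zero I).2 hadj
    rw [if_pos hcode, not_not, h.same u v hne]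
    constructor
    · rintro (⟨-, h₁⟩ | ⟨h₁, -⟩ | ⟨e, C, he, -⟩)
      · exact h₁
      · exact absurd h₁ hadj
      · refine absurd ?_ hadj
        rw [← SimpleGraph.mem_edgeSet, ← he]
        exact e.2
    · exact fun h₁ => .inl ⟨hadj, h₁⟩

lemma Describes.cost_eq (h : Describes g S) :
    cost I S = #(disagreementGraph I g).edgeFinset := by
  rw [cost, ← Set.ncard_coe_finset, SimpleGraph.coe_edgeFinset]
  congr 1
  ext e
  induction e with
  | h a b =>
    rw [SimpleGraph.mem_edgeSet]
    constructor
    · rintro ⟨u, v, hne, he, hd⟩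
      have hadj : (disagreementGraph I g).Adj u v := ⟨hne, (h.disagrees_iff hne).1 hd⟩
      rwa [← SimpleGraph.mem_edgeSet, ← he] at hadj
    · intro hd
      exact ⟨a, b, hd.1, rfl, (h.disagrees_iff hd.1).2 hd.2⟩

lemma Describes.two_mul_cost (h : Describes g S) :
    2 * cost I S = ∑ u, #{v | (disagreementGraph I g).Adj u v} := by
  rw [sum_card_adj, h.cost_eq]

/-- With `potential_le`, this places the potential between `k` and `k + 3` times twice the cost. -/
lemma mul_le_potential (k : ℕ) : k * ∑ u, #{v | (disagreementGraph I g).Adj u v} ≤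
    potential k (edgeCode I) g := by
  rw [mul_sum]
  refine sum_le_sum fun u _ => ?_
  rw [card_filter, mul_sum]
  refine sum_le_sum fun v _ => ?_
  split_ifs with h
  · rw [pairWeight, if_neg h.1, mul_one]
    exact le_weight h.2
  · simp

lemma potential_le (k : ℕ) : potential k (edgeCode I) g ≤
    (k + 3) * ∑ u, #{v | (disagreementGraph I g).Adj u v} := by
  rw [mul_sum]
  refine sum_le_sum fun u _ => ?_
  rw [card_filter, mul_sum]
  refine sum_le_sum fun v _ => ?_
  rw [pairWeight]
  split_ifs with h₁ h₂ h₃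
  · simp
  · simp
  · rw [mul_one]
    exact weight_le ..
  · rw [weight_of_agrees]
    · simp
    · by_contra hn
      exact h₃ ⟨h₁, hn⟩

/-- If an edge `u v` agrees, then every conflict forces a disagreement at `u` or `v`. -/
lemma disagreement_of_conflict {u v w : Fin n} (huv : edgeCode I u v ≠ 0)
    (hd : ¬ (disagreementGraph I g).Adj u v) (hw : w ∈ conflicts (edgeCode I) u v) :
    (disagreementGraph I g).Adj u w ∨ (disagreementGraph I g).Adj v w := by
  have hne : u ≠ v := by
    rintro rfl
    exact huv (edgeCode_self I u)
  rw [mem_conflicts] at hw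
  obtain ⟨hwu, hwv, hw⟩ := hw
  by_contra! hcon
  have a₁ : Agrees (edgeCode I u v) (g u) (g v) := by
    by_contra hn
    exact hd ⟨hne, hn⟩
  have a₂ : Agrees (edgeCode I u w) (g u) (g w) := by
    by_contra hn
    exact hcon.1 ⟨hwu.symm, hn⟩
  have a₃ : Agrees (edgeCode I v w) (g v) (g w) := by
    by_contra hn
    exact hcon.2 ⟨hwv.symm, hn⟩
  unfold Agrees at a₁ a₂ a₃
  grind

variable (S) in
-- Clusters are numbered through an enumeration of all subsets of the vertex set. Singletons get
-- labels too, and `none` is not needed here.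
lemma exists_describes : ∃ g, Describes g S := by
  have hpart : ∀ v, S.clusters.part v ∈ S.clusters.parts := fun v =>
    S.clusters.part_mem.2 (mem_univ v)
  let e : Finset (Fin n) → ℕ := fun C => Fintype.equivFin (Finset (Fin n)) C
  have he : Function.Injective e := fun a b h =>
    (Fintype.equivFin (Finset (Fin n))).injective (Fin.ext h)
  let g : Fin n → Option (ℕ × Fin m) := fun v =>
    some (e (S.clusters.part v), S.color ⟨S.clusters.part v, hpart v⟩)
  have hg : ∀ u v, g u = g v ↔ S.clusters.part u = S.clusters.part v := by
    intro u v
    constructor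
    · intro h
      simp only [g, Option.some_inj, Prod.mk.injEq] at h
      exact he h.1
    · intro h
      simp only [g, h]
  refine ⟨g, fun u v _ => ?_, fun C u v _ hu _ => ?_⟩
  · rw [hg, ← S.clusters.mem_part_iff_exists,
      S.clusters.mem_part_iff_part_eq_part (mem_univ u) (mem_univ v)]
    simp [g]
  · refine ⟨e (S.clusters.part u), ?_⟩
    have : (⟨S.clusters.part u, hpart u⟩ : {C // C ∈ S.clusters.parts}) = C :=
      Subtype.ext (S.clusters.part_eq_of_mem C.2 hu)
    simp only [g, this]

end Describes

/-! ### Solutions built from labelings -/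

lemma exists_mem_ofSetoid {s : Setoid (Fin n)} [DecidableRel s.r] {u v : Fin n} :
    (∃ K ∈ (Finpartition.ofSetoid s).parts, u ∈ K ∧ v ∈ K) ↔ s u v := by
  rw [← Finpartition.mem_part_iff_exists, Finpartition.mem_part_ofSetoid_iff_rel]
  exact ⟨s.symm, s.symm⟩

/-- The equivalence relation of lying in a common cluster of a labeling. -/
def labelSetoid (g : Fin n → Option (ℕ × Fin m)) : Setoid (Fin n) where
  r u v := u = v ∨ g u = g v ∧ g u ≠ none
  iseqv := by
    refine ⟨fun u => .inl rfl, ?_, ?_⟩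
    · rintro u v (h | ⟨h₁, h₂⟩)
      · exact .inl h.symm
      · exact .inr ⟨h₁.symm, h₁ ▸ h₂⟩
    · rintro u v w (rfl | ⟨h₁, h₂⟩) h
      · exact h
      · rcases h with rfl | ⟨h₃, -⟩
        · exact .inr ⟨h₁, h₂⟩
        · exact .inr ⟨h₁.trans h₃, h₂⟩

/-- The solution described by a labeling. -/
noncomputable def labelSolution (hm : 0 < m) (g : Fin n → Option (ℕ × Fin m)) :
    Solution (Fin n) (Fin m) where
  clusters := Finpartition.ofSetoid (labelSetoid g)
  -- All vertices of a cluster have the same label, so the chosen one does not matter. The default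
  -- color is used only for singletons labeled `none`.
  color C := ((g ((Finpartition.ofSetoid (labelSetoid g)).nonempty_of_mem_parts C.2).choose).map
    Prod.snd).getD ⟨0, hm⟩

lemma mem_labelSolution {hm : 0 < m} {g : Fin n → Option (ℕ × Fin m)} {u v : Fin n} :
    (∃ C ∈ (labelSolution hm g).clusters.parts, u ∈ C ∧ v ∈ C) ↔
      u = v ∨ g u = g v ∧ g u ≠ none := exists_mem_ofSetoid

lemma labelSolution_color {hm : 0 < m} {g : Fin n → Option (ℕ × Fin m)} {i : ℕ} {c : Fin m}
    (C : {C : Finset (Fin n) // C ∈ (labelSolution hm g).clusters.parts}) {u : Fin n}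
    (hu : u ∈ (C : Finset (Fin n))) (h : g u = some (i, c)) :
    (labelSolution hm g).color C = c := by
  have hne := (Finpartition.ofSetoid (labelSetoid g)).nonempty_of_mem_parts C.2
  have hgu : g hne.choose = g u := by
    rcases (mem_labelSolution (hm := hm) (g := g) (u := hne.choose) (v := u)).1 ⟨C, C.2, hne.choose_spec, hu⟩ with h | h
    · rw [h]
    · exact h.1
  change ((g hne.choose).map Prod.snd).getD ⟨0, hm⟩ = c
  rw [hgu, h]
  rfl

lemma describes_labelSolution (hm : 0 < m) (g : Fin n → Option (ℕ × Fin m)) :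
    Describes g (labelSolution hm g) := by
  refine ⟨fun u v hne => ?_, fun C u v hne hu hv => ?_⟩
  · rw [mem_labelSolution]
    simp [hne]
  · have h := ((mem_labelSolution (hm := hm)).1 ⟨C, C.2, hu, hv⟩).resolve_left hne
    obtain ⟨⟨i, c⟩, hic⟩ := Option.ne_none_iff_exists'.1 h.2
    exact ⟨i, by rw [labelSolution_color C hu hic, hic]⟩

/-! ## The preclustered instance -/

section Precluster

variable (I : Instance (Fin n) (Fin m)) (k : ℕ) (hm : 0 < m)

/-- The equivalence relation of lying in a common precluster. -/
def sameSetoid : Setoid (Fin n) where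
  r := Same (edgeCode I)
  iseqv := ⟨Same.refl, fun h => h.symm (edgeCode_comm I) (edgeCode_self I),
    fun h h' => h.trans (edgeCode_comm I) (edgeCode_self I) h'⟩

/-- The graph of admissible edges. -/
def admGraph : SimpleGraph (Fin n) where
  Adj := Adm (edgeCode I) k
  symm := ⟨fun _ _ h => h.symm (edgeCode_comm I) (edgeCode_self I)⟩
  loopless := ⟨fun _ h => h.1 (Same.refl _)⟩

/-- The color of the good edges at `u`, or color `0` if there are none. -/
noncomputable def hueColor (u : Fin n) : Fin m :=
  if h : hue (edgeCode I) u - 1 < m then ⟨hue (edgeCode I) u - 1, h⟩ else ⟨0, hm⟩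

/-- The preclustered instance computed by the algorithm. -/
noncomputable def precluster : Preclustering (Fin n) (Fin m) where
  parts := Finpartition.ofSetoid (sameSetoid I)
  color K := hueColor I hm
    ((Finpartition.ofSetoid (sameSetoid I)).nonempty_of_mem_parts K.2.1).choose
  adm := (admGraph I k).edgeFinset
  adm_across u v h := by
    rw [SimpleGraph.mem_edgeFinset, SimpleGraph.mem_edgeSet] at h
    refine ⟨h.ne, ?_⟩
    rw [exists_mem_ofSetoid]
    exact h.1

variable {I k hm}

lemma mem_precluster {u v : Fin n} :
    (∃ K ∈ (precluster I k hm).parts.parts, u ∈ K ∧ v ∈ K) ↔ Same (edgeCode I) u v :=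
  exists_mem_ofSetoid

lemma mem_precluster_adm {u v : Fin n} :
    s(u, v) ∈ (precluster I k hm).adm ↔ Adm (edgeCode I) k u v := by
  change s(u, v) ∈ (admGraph I k).edgeFinset ↔ _
  rw [SimpleGraph.mem_edgeFinset, SimpleGraph.mem_edgeSet]
  rfl

lemma Same.hue_eq {u v : Fin n} (h : Same (edgeCode I) u v) :
    hue (edgeCode I) u = hue (edgeCode I) v := by
  rcases h with rfl | ⟨h, -⟩
  · rfl
  · exact h.hue_eq (edgeCode_comm I) (edgeCode_self I)

lemma precluster_color (K : {K // K ∈ (precluster I k hm).parts.parts ∧ 1 < #K}) {u : Fin n}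
    (hu : u ∈ (K : Finset (Fin n))) : (precluster I k hm).color K = hueColor I hm u := by
  have hne := (precluster I k hm).parts.nonempty_of_mem_parts K.2.1
  have h := Same.hue_eq ((mem_precluster (hm := hm) (k := k) (I := I) (u := hne.choose) (v := u)).1 ⟨K, K.2.1, hne.choose_spec, hu⟩)
  change hueColor I hm hne.choose = _
  unfold hueColor
  simp only [h]

/-- The vertices of a precluster with at least two elements. -/
lemma precluster_facts (K : {K // K ∈ (precluster I k hm).parts.parts ∧ 1 < #K}) {u : Fin n}
    (hu : u ∈ (K : Finset (Fin n))) : (K : Finset (Fin n)) = cls (edgeCode I) u ∧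
      Kept (edgeCode I) u ∧ Heavy (edgeCode I) u := by
  obtain ⟨v, hv, hne⟩ := exists_mem_ne K.2.2 u
  have huv : Same (edgeCode I) u v := (mem_precluster (hm := hm) (k := k)).1 ⟨K, K.2.1, hu, hv⟩
  obtain ⟨hl, hk⟩ := huv.resolve_left hne.symm
  refine ⟨?_, hk, (hl.heavy_of_ne hne.symm).1⟩
  ext w
  rw [mem_cls]
  constructor
  · intro hw
    rcases (mem_precluster (hm := hm) (k := k) (I := I) (u := u) (v := w)).1 ⟨K, K.2.1, hu, hw⟩ with rfl | h
    · exact Linked.refl _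
    · exact h.1
  · intro hw
    obtain ⟨K', hK', hu', hw'⟩ := (mem_precluster (hm := hm) (k := k)).2 (.inr ⟨hw, hk⟩)
    rwa [(precluster I k hm).parts.eq_of_mem_parts K.2.1 hK' hu hu']

lemma Heavy.hueColor_add_one {u : Fin n} (h : Heavy (edgeCode I) u) :
    (hueColor I hm u : ℕ) + 1 = hue (edgeCode I) u := by
  obtain ⟨v, hv⟩ := h.exists_good
  have h₁ := hv.eq_hue (edgeCode_self I)
  have h₂ := edgeCode_le I u v
  have h₃ := hv.1
  rw [hueColor, dif_pos (by omega)]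
  simp only
  omega

/-- The solution described by an optimal labeling respects the preclustered instance. -/
theorem IsOptimal.respects {g : Fin n → Option (ℕ × Fin m)}
    (hg : IsOptimal k (edgeCode I) g) (hk : 3 ≤ k) :
    Respects (labelSolution hm g) (precluster I k hm) := by
  have hs := edgeCode_comm I
  have h0 := edgeCode_self I
  -- A nontrivial precluster is a kept class of heavy vertices, so it meets the density hypotheses
  -- of `IsOptimal.exists_label`.
  have hlabel : ∀ (K : {K // K ∈ (precluster I k hm).parts.parts ∧ 1 < #K}), ∃ i,
      ∀ v ∈ (K : Finset (Fin n)), g v = some (i, (precluster I k hm).color K) := by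
    intro K
    refine hg.exists_label hs hk _ K.2.2 (fun v hv => ?_) (fun v hv => ?_)
    · obtain ⟨h₁, h₂, h₃⟩ := precluster_facts K hv
      rw [precluster_color K hv, h₃.hueColor_add_one, h₁]
      exact h₂.card_off_color_le hs h0 h₃
    · obtain ⟨h₁, h₂, -⟩ := precluster_facts K hv
      rw [h₁]
      have := h₂.card_out_le
      omega
  refine ⟨fun K hK => ?_, fun K C hKC => ?_, fun u v huv => ?_⟩
  · obtain ⟨u, hu⟩ := (precluster I k hm).parts.nonempty_of_mem_parts hK
    obtain ⟨C, hC, huC⟩ := (labelSolution hm g).clusters.exists_mem (mem_univ u)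
    refine ⟨C, hC, fun v hv => ?_⟩
    rcases eq_or_ne v u with rfl | hne
    · exact huC
    · obtain ⟨i, hi⟩ := hlabel ⟨K, hK, one_lt_card.2 ⟨v, hv, u, hu, hne⟩⟩
      obtain ⟨C', hC', hu', hv'⟩ := (mem_labelSolution (hm := hm)).2
        (.inr ⟨(hi u hu).trans (hi v hv).symm, by simp [hi u hu]⟩)
      rwa [(labelSolution hm g).clusters.eq_of_mem_parts hC hC' huC hu']
  · obtain ⟨i, hi⟩ := hlabel K
    obtain ⟨u, hu⟩ := (precluster I k hm).parts.nonempty_of_mem_parts K.2.1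
    exact (labelSolution_color C (hKC hu) (hi u hu)).symm
  · obtain ⟨hne, hat, hadm⟩ := huv
    rw [mem_labelSolution]
    rintro (h | ⟨h₁, h₂⟩)
    · exact hne h
    rcases hg.same_or_adm hs h0 h₂ h₁ with h | h
    · exact hat ⟨hne, mem_precluster.2 h⟩
    · exact hadm (mem_precluster_adm.2 h)

/-! ### The two quantitative bounds -/

lemma exists_cost_eq_opt (hm : 0 < m) : ∃ S : Solution (Fin n) (Fin m), cost I S = opt I :=
  Nat.sInf_mem (s := Set.range (cost I))
    ⟨_, labelSolution hm fun _ => none, rfl⟩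

/-- Compare the minimizer of the potential with a labeling describing an optimal solution. -/
theorem exists_respects (hk : 3 ≤ k) : ∃ S : Solution (Fin n) (Fin m),
    Respects S (precluster I k hm) ∧ k * cost I S ≤ (k + 3) * opt I := by
  obtain ⟨g, hg⟩ := exists_isOptimal k (edgeCode I) (m := m)
  refine ⟨labelSolution hm g, hg.respects hk, ?_⟩
  obtain ⟨S, hS⟩ := exists_cost_eq_opt (I := I) hm
  obtain ⟨g', hg'⟩ := exists_describes S
  have h₁ := mul_le_potential (I := I) (g := g) k
  have h₂ := potential_le (I := I) (g := g') k
  rw [← (describes_labelSolution hm g).two_mul_cost] at h₁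
  rw [← hg'.two_mul_cost, hS] at h₂
  have h₃ := hg g'
  nlinarith

/-- The constant is 2 · 121 · 21 · 2001; passing from ordered to unordered pairs halves both sides.
-/
theorem card_adm_le : #(precluster I k hm).adm ≤ 10169082 * (k + 2) ^ 2 * opt I := by
  obtain ⟨S, hS⟩ := exists_cost_eq_opt (I := I) hm
  obtain ⟨g, hg⟩ := exists_describes S
  have h₁ := sum_not_same_le (edgeCode_comm I) (edgeCode_self I)
    (dis := (disagreementGraph I g).Adj) fun u v w => disagreement_of_conflict
  rw [← hg.two_mul_cost, hS] at h₁
  have h₂ := sum_adm_le (edgeCode_comm I) (edgeCode_self I) k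
  have h₃ : ∑ u, #{v | Adm (edgeCode I) k u v} = 2 * #(precluster I k hm).adm :=
    sum_card_adj (admGraph I k)
  rw [h₃] at h₂
  have h₄ := h₂.trans (Nat.mul_le_mul_left _ h₁)
  nlinarith

end Precluster


/-! ## The algorithm -/

namespace Ex

/-- `c * a` for a constant `c`. -/
def mulLit : ℕ → Ex → Ex
  | 0, _ => lit 0
  | c + 1, a => add (mulLit c a) a

/-- The truth value of `a < b`. -/
def lt (a b : Ex) : Ex := ite a b (lit 1) (lit 0)

/-- The truth value of `a ≤ b`. -/
def le (a b : Ex) : Ex := ite b a (lit 0) (lit 1)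

/-- The negation of a truth value. -/
def not (p : Ex) : Ex := ite (lit 0) p (lit 0) (lit 1)

/-- The conjunction of two truth values. -/
def and (p q : Ex) : Ex := ite (lit 0) p q (lit 0)

/-- The disjunction of two truth values. -/
def or (p q : Ex) : Ex := ite (lit 0) p (lit 1) q

/-- The truth value of `a = b`. -/
def eq (a b : Ex) : Ex := and (le a b) (le b a)

/-- Existential quantification over the values of a variable below `n`. -/
def ex (j : ℕ) (p : Ex) : Ex := lt (lit 0) (sum j p)

/-- Universal quantification over the values of a variable below `n`. -/
def all (j : ℕ) (p : Ex) : Ex := not (ex j (not p))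

/-- The least value of the variable `l + 1` for which `p` holds. -/
def first (l : ℕ) (p : Ex) : Ex :=
  sum l (all (l + 1) (or (not (le (var (l + 1)) (var l))) (not p)))

/-! In the following expressions, `x` and `y` are variables below `l`, and the bound variables are
`l` and larger. -/

/-- The code of the pair of `x` and the value of `a`. -/
def code (l x : ℕ) (a : Ex) : Ex := load (add (sum l (var x)) a)

def adj (l x y : ℕ) : Ex := lt (lit 0) (code l x (var y))

def mem_nbhd (l x y : ℕ) : Ex := or (eq (var y) (var x)) (adj l x y)

def card_nbhd (l x : ℕ) : Ex := sum l (mem_nbhd (l + 1) x l)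

def mem_conflicts (l x y w : ℕ) : Ex :=
  and (not (eq (var w) (var x))) <| and (not (eq (var w) (var y))) <| not <|
    and (eq (code l x (var w)) (code l y (var w))) <|
      or (eq (code l x (var w)) (lit 0)) (eq (code l x (var w)) (code l x (var y)))

def good (l x y : ℕ) : Ex :=
  and (adj l x y) <| le (mulLit 1000 (sum l (mem_conflicts (l + 1) x y l)))
    (add (card_nbhd l x) (card_nbhd l y))

def heavy (l x : ℕ) : Ex :=
  lt (add (mulLit 10 (sum l (and (adj (l + 1) x l) (not (good (l + 1) x l))))) (lit 1))
    (card_nbhd l x)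

def near (l x y : ℕ) : Ex := or (eq (var y) (var x)) (good l x y)

def linked (l x y : ℕ) : Ex :=
  or (eq (var x) (var y)) <| and (heavy l x) <| and (heavy l y) <|
    ex l (and (near (l + 1) x l) (near (l + 1) y l))

def kept (l x : ℕ) : Ex :=
  all l <| or (not (linked (l + 1) x l)) <|
    le (mulLit 60 (sum (l + 1)
      (and (mem_nbhd (l + 2) l (l + 1)) (not (linked (l + 2) l (l + 1))))))
      (sum (l + 1) (linked (l + 2) l (l + 1)))

def same (l x y : ℕ) : Ex := or (eq (var x) (var y)) (and (linked l x y) (kept l x))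

/-- `k + 2` times one plus the value of the variable `x`. -/
def scale (l x : ℕ) : Ex :=
  sum l (ite (var l) (add (var x) (lit 1)) (add parK (lit 2)) (lit 0))

/-- The scale `c` is one plus the variable `l`, hence ranges over `1, …, n`. The product with `k +
2` is obtained by adding `k + 2` once per common neighbor. -/
def adm (l x y : ℕ) : Ex :=
  and (not (same l x y)) <| ex l <| le (add (var l) (lit 1)) <|
    sum (l + 1) (ite (lit 0)
      (and (mem_nbhd (l + 2) x (l + 1)) <| and (mem_nbhd (l + 2) y (l + 1)) <|
        le (card_nbhd (l + 2) (l + 1)) (scale (l + 2) l))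
      (add parK (lit 2)) (lit 0))

def name (l x : ℕ) : Ex := first l (same (l + 2) x (l + 1))

def color (l x : ℕ) : Ex := sub (code l x (first l (good (l + 2) x (l + 1)))) (lit 1)

end Ex

/-! ### The values of the expressions -/

section Values

variable {k n : ℕ} {input : ℕ → ℕ}

variable (k n input) in
/-- `e` evaluates to the truth value of `P`. -/
def Decides (e : Ex) (ρ : ℕ → ℕ) (P : Prop) : Prop :=
  e.eval k n input ρ = if P then 1 else 0

/-- The variable `x` is below `l` and has the value `u`. -/
def Bound (ρ : ℕ → ℕ) (l x : ℕ) (u : Fin n) : Prop := x < l ∧ ρ x = u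

lemma Bound.lift {ρ : ℕ → ℕ} {l x : ℕ} {u : Fin n} (h : Bound ρ l x u) (i : ℕ) :
    Bound (Function.update ρ l i) (l + 1) x u :=
  ⟨by have := h.1; omega, by rw [Function.update_of_ne h.1.ne, h.2]⟩

lemma Bound.new (ρ : ℕ → ℕ) (l : ℕ) (i : Fin n) : Bound (Function.update ρ l i) (l + 1) l i :=
  ⟨by omega, by simp⟩

lemma Bound.eval_var {ρ : ℕ → ℕ} {l x : ℕ} {u : Fin n} (h : Bound ρ l x u) :
    (Ex.var x).eval k n input ρ = u := h.2

lemma eval_mulLit (c : ℕ) (a : Ex) (ρ : ℕ → ℕ) :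
    (Ex.mulLit c a).eval k n input ρ = c * a.eval k n input ρ := by
  induction c with
  | zero => simp [Ex.mulLit, Ex.eval]
  | succ c ih => rw [Ex.mulLit, Ex.eval, ih, Nat.succ_mul]

variable {ρ : ℕ → ℕ} {a b p q : Ex} {P Q : Prop} {x y : ℕ}

lemma Decides.congr (h : Decides k n input p ρ P) (hPQ : P ↔ Q) : Decides k n input p ρ Q := by
  rwa [← propext hPQ]

lemma decides_lt (ha : a.eval k n input ρ = x) (hb : b.eval k n input ρ = y) :
    Decides k n input (a.lt b) ρ (x < y) := by
  simp [Decides, Ex.lt, Ex.eval, ha, hb]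

lemma decides_le (ha : a.eval k n input ρ = x) (hb : b.eval k n input ρ = y) :
    Decides k n input (a.le b) ρ (x ≤ y) := by
  rw [Decides, Ex.le, Ex.eval, ha, hb]
  simp only [Ex.eval]
  split_ifs <;> omega

lemma Decides.not (h : Decides k n input p ρ P) : Decides k n input p.not ρ (¬ P) := by
  rw [Decides] at *
  simp only [Ex.not, Ex.eval, h]
  by_cases hP : P <;> simp [hP]

lemma Decides.and (hp : Decides k n input p ρ P) (hq : Decides k n input q ρ Q) :
    Decides k n input (p.and q) ρ (P ∧ Q) := by
  rw [Decides] at *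
  simp only [Ex.and, Ex.eval, hp, hq]
  by_cases hP : P <;> simp [hP]

lemma Decides.or (hp : Decides k n input p ρ P) (hq : Decides k n input q ρ Q) :
    Decides k n input (p.or q) ρ (P ∨ Q) := by
  rw [Decides] at *
  simp only [Ex.or, Ex.eval, hp, hq]
  by_cases hP : P <;> simp [hP]

lemma decides_eq (ha : a.eval k n input ρ = x) (hb : b.eval k n input ρ = y) :
    Decides k n input (a.eq b) ρ (x = y) :=
  ((decides_le ha hb).and (decides_le hb ha)).congr le_antisymm_iff.symm

lemma Bound.decides_eq {l : ℕ} {u v : Fin n} (hu : Bound ρ l x u) (hv : Bound ρ l y v) :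
    Decides k n input ((Ex.var x).eq (.var y)) ρ (u = v) :=
  (ChromaticCC.decides_eq hu.eval_var hv.eval_var).congr Fin.ext_iff.symm

lemma eval_sum (j : ℕ) (p : Ex) (F : Fin n → ℕ)
    (h : ∀ i : Fin n, p.eval k n input (Function.update ρ j i) = F i) :
    (Ex.sum j p).eval k n input ρ = ∑ i, F i := by
  rw [Ex.eval, Finset.sum_range]
  exact sum_congr rfl fun i _ => h i

lemma eval_count (j : ℕ) {s : Finset (Fin n)}
    (h : ∀ i : Fin n, Decides k n input p (Function.update ρ j i) (i ∈ s)) :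
    (Ex.sum j p).eval k n input ρ = #s := by
  rw [eval_sum j p (fun i => if i ∈ s then 1 else 0) fun i => (h i).trans (by congr)]
  simp

lemma decides_ex (j : ℕ) {R : Fin n → Prop}
    (h : ∀ i : Fin n, Decides k n input p (Function.update ρ j i) (R i)) :
    Decides k n input (.ex j p) ρ (∃ i, R i) := by
  refine (decides_lt (x := 0) rfl (eval_count j (s := {i | R i})
    fun i => (h i).congr (by simp))).congr ?_
  rw [card_pos]
  simp [Finset.Nonempty]

lemma decides_all (j : ℕ) {R : Fin n → Prop}
    (h : ∀ i : Fin n, Decides k n input p (Function.update ρ j i) (R i)) :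
    Decides k n input (.all j p) ρ (∀ i, R i) :=
  (decides_ex j fun i => (h i).not).not.congr (by simp)

/-- The number of the least vertex satisfying `R`. -/
noncomputable def leastVertex (R : Fin n → Prop) : ℕ := #{i : Fin n | ∀ j, ¬ j ≤ i ∨ ¬ R j}

/-- The `i` with no solution up to `i` are exactly the numbers below the least solution, so counting
them yields it. -/
lemma leastVertex_spec {R : Fin n → Prop} (h : ∃ i, R i) :
    ∃ i : Fin n, R i ∧ leastVertex R = i := by
  obtain ⟨i, hi, hmin⟩ := wellFounded_lt.has_min {i : Fin n | R i} h
  refine ⟨i, hi, ?_⟩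
  rw [leastVertex, ← Fin.card_Iio i]
  congr 1
  ext j
  simp only [mem_filter, mem_univ, true_and, mem_Iio]
  constructor
  · intro hj
    by_contra! hle
    exact (hj i).elim (fun h => h hle) fun h => h hi
  · intro hj w
    by_contra! hw
    exact hmin w hw.2 (hw.1.trans_lt hj)

lemma eval_first {l : ℕ} {R : Fin n → Prop} (h : ∀ i j : Fin n, Decides k n input p
    (Function.update (Function.update ρ l i) (l + 1) j) (R j)) :
    (Ex.first l p).eval k n input ρ = leastVertex R := by
  refine eval_count l fun i => (decides_all (l + 1)
    (R := fun j => ¬ j ≤ i ∨ ¬ R j) fun j => ?_).congr (by simp)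
  refine Decides.or ?_ (h i j).not
  exact (decides_le (Bound.new _ _ j).eval_var ((Bound.new ρ l i).lift j).eval_var).not.congr
    (by rw [Fin.le_def])

/-! ### Correctness of the expressions for the graph notions -/

variable {f : Fin n → Fin n → ℕ} (hf : ∀ u v : Fin n, input (n * u + v) = f u v)
  {l w : ℕ} {u v z : Fin n}
include hf

/-- The machine cannot multiply; the row offset `n * u` is the sum of `n` copies of `u`. -/
lemma eval_code (hx : Bound ρ l x u) (ha : a.eval k n input ρ = v) :
    (Ex.code l x a).eval k n input ρ = f u v := by
  have : (Ex.sum l (.var x)).eval k n input ρ = n * u := by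
    rw [eval_sum l _ (fun _ => (u : ℕ)) fun i => (hx.lift i).eval_var]
    simp
  rw [Ex.code, Ex.eval, Ex.eval, this, ha, hf]

lemma decides_adj (hx : Bound ρ l x u) (hy : Bound ρ l y v) :
    Decides k n input (.adj l x y) ρ (f u v ≠ 0) :=
  (decides_lt (x := 0) rfl (eval_code hf hx hy.eval_var)).congr Nat.pos_iff_ne_zero

lemma decides_mem_nbhd (hx : Bound ρ l x u) (hy : Bound ρ l y v) :
    Decides k n input (.mem_nbhd l x y) ρ (v ∈ nbhd f u) :=
  ((hy.decides_eq hx).or (decides_adj hf hx hy)).congr mem_nbhd.symm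

lemma eval_card_nbhd (hx : Bound ρ l x u) :
    (Ex.card_nbhd l x).eval k n input ρ = #(nbhd f u) := by
  rw [Ex.card_nbhd, eval_count l fun i => decides_mem_nbhd hf (hx.lift i) (Bound.new ρ l i)]

lemma decides_mem_conflicts (hx : Bound ρ l x u) (hy : Bound ρ l y v) (hw : Bound ρ l w z) :
    Decides k n input (.mem_conflicts l x y w) ρ (z ∈ conflicts f u v) := by
  have e₁ := eval_code (k := k) hf hx hw.eval_var
  have e₂ := eval_code (k := k) hf hy hw.eval_var
  have e₃ := eval_code (k := k) hf hx hy.eval_var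
  exact ((hw.decides_eq hx).not.and <| (hw.decides_eq hy).not.and <| Decides.not <|
    (decides_eq e₁ e₂).and <| (decides_eq e₁ rfl).or (decides_eq e₁ e₃)).congr
    mem_conflicts.symm

lemma decides_good (hx : Bound ρ l x u) (hy : Bound ρ l y v) :
    Decides k n input (.good l x y) ρ (Good f u v) := by
  refine (decides_adj hf hx hy).and (decides_le ?_ ?_)
  · rw [eval_mulLit, eval_count l fun i =>
      decides_mem_conflicts hf (hx.lift i) (hy.lift i) (Bound.new ρ l i)]
  · rw [Ex.eval, eval_card_nbhd hf hx, eval_card_nbhd hf hy]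

lemma decides_heavy (hx : Bound ρ l x u) : Decides k n input (.heavy l x) ρ (Heavy f u) := by
  refine decides_lt ?_ (eval_card_nbhd hf hx)
  rw [Ex.eval, eval_mulLit, eval_count l fun i =>
    ((decides_adj hf (hx.lift i) (Bound.new ρ l i)).and
    (decides_good hf (hx.lift i) (Bound.new ρ l i)).not).congr mem_bad.symm]
  rfl

lemma decides_near (hx : Bound ρ l x u) (hy : Bound ρ l y v) :
    Decides k n input (.near l x y) ρ (Near f u v) :=
  (hy.decides_eq hx).or (decides_good hf hx hy)

lemma decides_linked (hx : Bound ρ l x u) (hy : Bound ρ l y v) :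
    Decides k n input (.linked l x y) ρ (Linked f u v) :=
  (hx.decides_eq hy).or <| (decides_heavy hf hx).and <| (decides_heavy hf hy).and <|
    decides_ex l fun i => (decides_near hf (hx.lift i) (Bound.new ρ l i)).and
      (decides_near hf (hy.lift i) (Bound.new ρ l i))

lemma decides_kept (hx : Bound ρ l x u) : Decides k n input (.kept l x) ρ (Kept f u) := by
  unfold Kept
  refine decides_all l fun i => Decides.congr ?_ imp_iff_not_or.symm
  refine (decides_linked hf (hx.lift i) (Bound.new ρ l i)).not.or (decides_le ?_ ?_)
  · rw [eval_mulLit]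
    congr 1
    refine eval_count (l + 1) fun j =>
      ((decides_mem_nbhd hf ((Bound.new ρ l i).lift j) (Bound.new _ (l + 1) j)).and
      (decides_linked hf ((Bound.new ρ l i).lift j) (Bound.new _ (l + 1) j)).not).congr ?_
    exact mem_nbhd_sdiff_cls.symm
  · exact eval_count (l + 1) fun j =>
      (decides_linked hf ((Bound.new ρ l i).lift j) (Bound.new _ (l + 1) j)).congr mem_cls.symm

lemma decides_same (hx : Bound ρ l x u) (hy : Bound ρ l y v) :
    Decides k n input (.same l x y) ρ (Same f u v) :=
  (hx.decides_eq hy).or ((decides_linked hf hx hy).and (decides_kept hf hx))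

omit hf in
lemma eval_scale (hx : Bound ρ l x u) :
    (Ex.scale l x).eval k n input ρ = (k + 2) * (u + 1) := by
  rw [Ex.scale, eval_sum l _ (fun i : Fin n => if i ≤ u then k + 2 else 0)]
  · rw [← sum_filter, sum_const, smul_eq_mul, mul_comm]
    congr 1
    rw [← Fin.card_Iic u]
    congr 1
    ext i
    simp
  · intro i
    simp only [Ex.eval, (hx.lift i).2, (Bound.new ρ l i).2, Fin.le_def, Nat.lt_succ_iff]

lemma decides_adm (hx : Bound ρ l x u) (hy : Bound ρ l y v) :
    Decides k n input (.adm l x y) ρ (Adm f k u v) := by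
  refine ((decides_same hf hx hy).not.and (decides_ex l (R := fun i : Fin n => (i + 1 : ℕ) ≤
    (k + 2) * #(common f k u v (i + 1)))
    fun i => ?_)).congr (and_congr_right fun _ => ?_)
  · refine decides_le (by rw [Ex.eval, (Bound.new ρ l i).eval_var]; rfl) ?_
    rw [eval_sum (l + 1) _ fun j => if j ∈ common f k u v (i + 1) then k + 2 else 0]
    · rw [← sum_filter, filter_univ_mem, sum_const, smul_eq_mul, mul_comm]
    intro j
    have h := ((decides_mem_nbhd (k := k) hf ((hx.lift i).lift j) (Bound.new _ (l + 1) j)).and <|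
      (decides_mem_nbhd (k := k) hf ((hy.lift i).lift j) (Bound.new _ (l + 1) j)).and <|
      decides_le (eval_card_nbhd (k := k) hf (Bound.new _ (l + 1) j))
        (eval_scale ((Bound.new ρ l i).lift j))).congr mem_common.symm
    rw [Decides] at h
    rw [Ex.eval, h]
    simp only [Ex.eval]
    split_ifs <;> simp_all
  · constructor
    · rintro ⟨i, hi⟩
      exact ⟨i + 1, by omega, by rw [Fintype.card_fin]; omega, hi⟩
    · rintro ⟨c, h₁, h₂, h₃⟩
      rw [Fintype.card_fin] at h₂
      refine ⟨⟨c - 1, by omega⟩, ?_⟩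
      simpa only [Nat.sub_add_cancel h₁] using h₃

lemma eval_name (hx : Bound ρ l x u) :
    (Ex.name l x).eval k n input ρ = leastVertex (Same f u) :=
  eval_first fun i j => decides_same hf ((hx.lift i).lift j) (Bound.new _ (l + 1) j)

lemma eval_color (h0 : ∀ u, f u u = 0) (hx : Bound ρ l x u) (hu : ∃ v, Good f u v) :
    (Ex.color l x).eval k n input ρ = hue f u - 1 := by
  obtain ⟨v, hv, hlv⟩ := leastVertex_spec hu
  have h : (Ex.first l (.good (l + 2) x (l + 1))).eval k n input ρ = v := by
    rw [eval_first fun i j => decides_good hf ((hx.lift i).lift j) (Bound.new _ (l + 1) j), hlv]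
  rw [Ex.color, Ex.eval, eval_code hf hx h, hv.eq_hue h0]
  rfl

end Values

/-! ### The program -/

lemma Stmt.eval_loop_induction {k n : ℕ} {input ρ : ℕ → ℕ} {j : ℕ} {p : Stmt}
    {A : ℕ → ℕ → ℕ} (Inv : ℕ → (ℕ → ℕ → ℕ) → Prop) (hzero : Inv 0 A)
    (hstep : ∀ i, i < n → ∀ B, Inv i B → Inv (i + 1)
      (p.eval k n input (Function.update ρ j i) B)) :
    Inv n ((Stmt.loop j p).eval k n input ρ A) := by
  have : ∀ r, r ≤ n →
      Inv r (Nat.rec A (fun i B => p.eval k n input (Function.update ρ j i) B) r) := by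
    intro r
    induction r with
    | zero => exact fun _ => hzero
    | succ r ih => exact fun hr => hstep r (by omega) _ (ih (by omega))
  exact this n le_rfl

/-- Fill array `a + 1` with the values of `e`. -/
def Stmt.fill (a : ℕ) (e : Ex) : Stmt := .loop 0 (.store a (.var 0) e)

/-- Fill the matrix in array `a + 1` with the values of `e`. -/
def Stmt.fillMatrix (a : ℕ) (e : Ex) : Stmt :=
  .loop 0 (.loop 1 (.store a (.add (.sum 2 (.var 0)) (.var 1)) e))

lemma Stmt.eval_fill {k n : ℕ} {input ρ : ℕ → ℕ} (a : ℕ) (e : Ex) (A : ℕ → ℕ → ℕ) :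
    (∀ u, u < n → (fill a e).eval k n input ρ A (a + 1) u =
      e.eval k n input (Function.update ρ 0 u)) ∧
    ∀ b, b ≠ a + 1 → (fill a e).eval k n input ρ A b = A b := by
  refine eval_loop_induction (Inv := fun i B => (∀ u, u < i → B (a + 1) u =
    e.eval k n input (Function.update ρ 0 u)) ∧ ∀ b, b ≠ a + 1 → B b = A b)
    ⟨fun u hu => absurd hu (by omega), fun _ _ => rfl⟩ ?_
  rintro i hi B ⟨h₁, h₂⟩
  refine ⟨fun u hu => ?_, fun b hb => ?_⟩
  · by_cases hui : u = i
    · subst hui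
      simp [eval, Ex.eval]
    · simp [eval, Ex.eval, hui, h₁ u (by omega)]
  · simp [eval, hb, h₂ b hb]

lemma Stmt.eval_fillMatrix {k n : ℕ} {input ρ : ℕ → ℕ} (a : ℕ) (e : Ex) (A : ℕ → ℕ → ℕ) :
    (∀ u, u < n → ∀ v, v < n → (fillMatrix a e).eval k n input ρ A (a + 1) (n * u + v) =
      e.eval k n input (Function.update (Function.update ρ 0 u) 1 v)) ∧
    ∀ b, b ≠ a + 1 → (fillMatrix a e).eval k n input ρ A b = A b := by
  refine eval_loop_induction (Inv := fun i B => (∀ u, u < i → ∀ v, v < n →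
    B (a + 1) (n * u + v) = e.eval k n input (Function.update (Function.update ρ 0 u) 1 v)) ∧
    ∀ b, b ≠ a + 1 → B b = A b)
    ⟨fun u hu => absurd hu (by omega), fun _ _ => rfl⟩ ?_
  rintro i hi B ⟨h₁, h₂⟩
  have h := eval_loop_induction (k := k) (n := n) (input := input)
    (ρ := Function.update ρ 0 i) (j := 1) (A := B)
    (p := .store a (.add (.sum 2 (.var 0)) (.var 1)) e) (Inv := fun j B =>
    ((∀ u, u < i → ∀ v, v < n → B (a + 1) (n * u + v) =
      e.eval k n input (Function.update (Function.update ρ 0 u) 1 v)) ∧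
    (∀ v, v < j → B (a + 1) (n * i + v) =
      e.eval k n input (Function.update (Function.update ρ 0 i) 1 v))) ∧
    ∀ b, b ≠ a + 1 → B b = A b) ⟨⟨h₁, fun v hv => absurd hv (by omega)⟩, h₂⟩ (by
      rintro j hj C ⟨⟨h₃, h₄⟩, h₅⟩
      have hidx : (Ex.add (.sum 2 (.var 0)) (.var 1)).eval k n input
          (Function.update (Function.update ρ 0 i) 1 j) = n * i + j := by
        simp [Ex.eval]
      -- Distinct positions of the matrix occupy distinct cells, so no later store overwrites an
      -- entry.
      have hinj : ∀ u v, v < n → n * u + v = n * i + j → u = i ∧ v = j := by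
        intro u v hv heq
        have hu : (n * u + v) / n = u := by
          rw [Nat.mul_add_div (by omega), Nat.div_eq_of_lt hv, add_zero]
        have hi : (n * i + j) / n = i := by
          rw [Nat.mul_add_div (by omega), Nat.div_eq_of_lt hj, add_zero]
        have : u = i := by rw [← hu, heq, hi]
        subst this
        exact ⟨rfl, by omega⟩
      refine ⟨⟨fun u hu v hv => ?_, fun v hv => ?_⟩, fun b hb => ?_⟩
      · rw [eval, hidx, Function.update_self, Function.update_of_ne, h₃ u hu v hv]
        exact fun heq => by have := (hinj u v hv heq).1; omega
      · rw [eval, hidx, Function.update_self]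
        by_cases hvj : v = j
        · subst hvj
          rw [Function.update_self]
        · rw [Function.update_of_ne (by omega), h₄ v (by omega)]
      · rw [eval, Function.update_of_ne hb, h₅ b hb])
  refine ⟨fun u hu v hv => ?_, h.2⟩
  by_cases hui : u = i
  · subst hui
    exact h.1.2 v hv
  · exact h.1.1 u (by omega) v hv

/-- The algorithm: output the names of the preclusters, their colors, and the admissible edges. -/
def preclusterStmt : Stmt :=
  .seq (.fill 0 (.name 1 0)) (.seq (.fill 1 (.color 1 0)) (.fillMatrix 2 (.adm 2 0 1)))

variable {n m : ℕ} {I : Instance (Fin n) (Fin m)} {k : ℕ} {hm : 0 < m}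

lemma inputState_arr (u v : Fin n) :
    (inputState k I).arr 0 (n * u + v) = edgeCode I u v := by
  have hn : 0 < n := u.pos
  have h : n * (u : ℕ) + v < n * n := by
    have := Nat.mul_le_mul_left n (Nat.succ_le_of_lt u.isLt)
    rw [Nat.mul_succ] at this
    omega
  have h₁ : (n * (u : ℕ) + v) / n = u := by
    rw [Nat.mul_add_div hn, Nat.div_eq_of_lt v.isLt, add_zero]
  have h₂ : (n * (u : ℕ) + v) % n = v := by
    rw [Nat.mul_add_mod, Nat.mod_eq_of_lt v.isLt]
  simp only [inputState, true_and, h, dif_pos, h₁, h₂]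

lemma represents_inputState :
    Represents k n ((inputState k I).arr 0) (fun _ => 0) (inputState k I) where
  parK := by simp [inputState]
  parN := by simp [inputState]
  var j := by
    simp only [inputState, varReg]
    rw [if_neg (by omega), if_neg (by omega), if_neg (by omega)]
  input := rfl

/-- A precluster is named by its least vertex, which determines it. -/
lemma leastVertex_same {u v : Fin n} :
    leastVertex (Same (edgeCode I) u) = leastVertex (Same (edgeCode I) v) ↔
      Same (edgeCode I) u v := by
  have hs := edgeCode_comm I
  have h0 := edgeCode_self I
  constructor
  · intro h
    obtain ⟨i, hi, hil⟩ := leastVertex_spec (R := Same (edgeCode I) u) ⟨u, Same.refl u⟩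
    obtain ⟨j, hj, hjl⟩ := leastVertex_spec (R := Same (edgeCode I) v) ⟨v, Same.refl v⟩
    have hij : i = j := Fin.ext (by rw [← hil, ← hjl, h])
    exact hi.trans hs h0 ((hij ▸ hj).symm hs h0)
  · intro h
    congr 1
    ext w
    exact ⟨fun hw => (h.symm hs h0).trans hs h0 hw, fun hw => h.trans hs h0 hw⟩

theorem outputs_precluster {s : State} (h : s.arr =
    preclusterStmt.eval k n ((inputState k I).arr 0) (fun _ => 0) (inputState k I).arr) :
    Outputs s (precluster I k hm) := by
  have hf : ∀ u v : Fin n, (inputState k I).arr 0 (n * u + v) = edgeCode I u v := inputState_arr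
  simp only [preclusterStmt, Stmt.eval] at h
  set ρ : ℕ → ℕ := fun _ => 0
  set A := (inputState k I).arr
  set B := (Stmt.fill 0 (.name 1 0)).eval k n (A 0) ρ A with hB
  set C := (Stmt.fill 1 (.color 1 0)).eval k n (A 0) ρ B with hC
  obtain ⟨b₁, -⟩ := Stmt.eval_fill (k := k) (n := n) (input := A 0) (ρ := ρ) 0 (.name 1 0) A
  obtain ⟨c₁, c₂⟩ := Stmt.eval_fill (k := k) (n := n) (input := A 0) (ρ := ρ) 1 (.color 1 0) B
  obtain ⟨d₁, d₂⟩ :=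
    Stmt.eval_fillMatrix (k := k) (n := n) (input := A 0) (ρ := ρ) 2 (.adm 2 0 1) C
  rw [← h] at d₁ d₂
  have hname : ∀ u : Fin n, s.arr 1 u = leastVertex (Same (edgeCode I) u) := by
    intro u
    rw [d₂ 1 (by norm_num), hC, c₂ 1 (by norm_num), hB, b₁ u u.isLt]
    exact eval_name hf (Bound.new ρ 0 u)
  refine ⟨fun u v => ?_, fun K u hu => ?_, fun u v => ?_⟩
  · rw [hname, hname, leastVertex_same, mem_precluster]
  -- Vertices of nontrivial preclusters are heavy, so the search for a good neighbor, from which the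
  -- color is read, succeeds.
  · obtain ⟨-, -, hh⟩ := precluster_facts K hu
    have hhue := hh.hueColor_add_one (hm := hm)
    rw [d₂ 2 (by norm_num), hC, c₁ u u.isLt, precluster_color K hu,
      eval_color hf (edgeCode_self I) (Bound.new ρ 0 u) hh.exists_good]
    omega
  · rw [d₁ u u.isLt v v.isLt]
    simp only [mem_precluster_adm]
    exact decides_adm hf ((Bound.new ρ 0 u).lift v) (Bound.new _ 1 v)

end ChromaticCC

/-- There is one program which, for all small `ε > 0` and every instance with `n` vertices and at
least one color, given the integer `⌈1/ε⌉` and the instance, halts after at most `p (n, 1/ε)` steps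
with a preclustered instance as output that is respected by some solution of cost at most
`(1 + C₁ ε) opt`, and that has at most `C₂ ε⁻² opt` admissible edges. -/
theorem theorem2 :
    ∃ (A : ChromaticCC.Program) (p : MvPolynomial (Fin 2) ℝ) (ε₀ C₁ C₂ : ℝ), 0 < ε₀ ∧
      ∀ ε : ℝ, 0 < ε → ε < ε₀ →
        ∀ (n m : ℕ) (I : ChromaticCC.Instance (Fin n) (Fin m)), 0 < m →
          ∃ (t : ℕ) (s : ChromaticCC.State) (P : ChromaticCC.Preclustering (Fin n) (Fin m)),
            ChromaticCC.Exec A (ChromaticCC.inputState ⌈1 / ε⌉₊ I) s t ∧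
            (t : ℝ) ≤ MvPolynomial.eval ![(n : ℝ), 1 / ε] p ∧
            ChromaticCC.Outputs s P ∧
            (∃ S : ChromaticCC.Solution (Fin n) (Fin m), ChromaticCC.Respects S P ∧
              (ChromaticCC.cost I S : ℝ) ≤ (1 + C₁ * ε) * (ChromaticCC.opt I : ℝ)) ∧
            (P.adm.card : ℝ) ≤ C₂ * (ε ^ 2)⁻¹ * (ChromaticCC.opt I : ℝ) := by
  refine ⟨ChromaticCC.preclusterStmt.compile 0,
    Polynomial.aeval (MvPolynomial.X 0) ChromaticCC.preclusterStmt.time,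
    -- `ε < 1/3` ensures `k ≥ 3`; `(k + 3) / k ≤ 1 + 3ε` because `k ≥ 1/ε`; and `k + 2 < 1/ε + 3 <
    -- 2/ε` produces the factor 4.
    1 / 3, 3, 4 * 10169082, by norm_num, ?_⟩
  intro ε hε hε₀ n m I hm
  set k := ⌈1 / ε⌉₊ with hk
  have hlt : 3 < 1 / ε := by
    rw [lt_div_iff₀ hε]
    linarith
  have hk₁ : 1 / ε ≤ k := Nat.le_ceil _
  have hk₂ : (k : ℝ) < 1 / ε + 1 := Nat.ceil_lt_add_one (by positivity)
  have hk₃ : 3 ≤ k := by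
    have : (3 : ℝ) < k := by linarith
    exact_mod_cast this.le
  obtain ⟨s, t, hexec, ht, harr, -⟩ := ChromaticCC.preclusterStmt.exec_compile k n _ 0 _ _
    (ChromaticCC.represents_inputState (I := I) (k := k))
  obtain ⟨S, hS, hcost⟩ := ChromaticCC.exists_respects (I := I) (hm := hm) hk₃
  refine ⟨t, s, ChromaticCC.precluster I k hm, hexec, ?_,
    ChromaticCC.outputs_precluster harr, ⟨S, hS, ?_⟩, ?_⟩
  · have : MvPolynomial.eval ![(n : ℝ), 1 / ε] (Polynomial.aeval (MvPolynomial.X 0)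
        ChromaticCC.preclusterStmt.time) = (ChromaticCC.preclusterStmt.time.eval n : ℕ) := by
      rw [Polynomial.aeval_def, Polynomial.hom_eval₂, MvPolynomial.eval_X,
        Matrix.cons_val_zero, Polynomial.eval₂_at_natCast]
      exact eq_natCast _ _
    rw [this]
    exact_mod_cast ht
  · have hcost' : (k : ℝ) * ChromaticCC.cost I S ≤ (k + 3) * ChromaticCC.opt I := by
      exact_mod_cast hcost
    have hkpos : (0 : ℝ) < k := by linarith
    have hεk : 1 ≤ ε * k := by
      rw [div_le_iff₀ hε] at hk₁
      linarith
    have hopt : (0 : ℝ) ≤ ChromaticCC.opt I := Nat.cast_nonneg _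
    refine le_of_mul_le_mul_left (hcost'.trans ?_) hkpos
    nlinarith
  · have hadm : ((ChromaticCC.precluster I k hm).adm.card : ℝ) ≤
        10169082 * (k + 2) ^ 2 * ChromaticCC.opt I := by
      exact_mod_cast ChromaticCC.card_adm_le (I := I) (hm := hm) (k := k)
    refine hadm.trans (mul_le_mul_of_nonneg_right ?_ (Nat.cast_nonneg _))
    have h₁ : (k + 2 : ℝ) ≤ 2 * (1 / ε) := by linarith
    have h₂ : (k + 2 : ℝ) ^ 2 ≤ (2 * (1 / ε)) ^ 2 := by gcongr
    calc (10169082 : ℝ) * (k + 2) ^ 2 ≤ 10169082 * (2 * (1 / ε)) ^ 2 := by gcongr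
      _ = 4 * 10169082 * (ε ^ 2)⁻¹ := by
        field_simp
        ring
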